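/- Let $d\in\{2,3\}$. Let $\Omega_1,\Omega_2\subset\mathbb R^d$ be disjoint bounded open sets whose boundaries are Lebesgue null sets (for instance Lipschitz), let $\Omega=(\overline{\Omega_1\cup\Omega_2})^\circ$ and $\Gamma=\partial\overline\Omega_1\cap\partial\overline\Omega_2$, and let $\boldsymbol n$ be the unit normal of $\Gamma$ pointing out of $\Omega_2$ into $\Omega_1$. Let $\mathcal T_0$ and $\mathcal T_2$ be finite conforming meshes of (closed, nondegenerate) simplices covering $\overline\Omega$ and $\overline\Omega_2$, respectively, that are shape regular with constant $\sigma>0$: every element $T$ satisfies $h_T\le\sigma\rho_T$, where $h_T$ is the diameter of $T$ and $\rho_T$ the diameter of the largest ball contained in $T$. Put $$\mathcal T_1^*=\{T\in\mathcal T_0: T\subset\overline\Omega_1\}\cup\{T\in\mathcal T_0: |T\cap\Omega_1|>0 \text{ and } |T\cap\Omega_2|>0\},\qquad \Omega_1^*=\bigcup_{T\in\mathcal T_1^*}T,\qquad \Omega_O=\Omega_2\cap\Omega_1^*.$$ For $k\ge 0$ let $V_h=V_{h,1}\oplus V_{h,2}$, where $V_{h,1}$ and $V_{h,2}$ are the spaces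 of continuous $\mathbb R^d$-valued vector fields on $\Omega_1^*$ and $\overline\Omega_2$ that are polynomial of degree at most $k$ on each element of $\mathcal T_1^*$ and of $\mathcal T_2$, respectively. For $\boldsymbol v_h=(\boldsymbol v_{h,1},\boldsymbol v_{h,2})\in V_h$ write $[\boldsymbol v_h]=\boldsymbol v_{h,2}-\boldsymbol v_{h,1}$ and $\langle\partial_{\boldsymbol n}\boldsymbol v_h\rangle=\partial_{\boldsymbol n}\boldsymbol v_{h,2}$ on $\Gamma$ (with the derivative of $\boldsymbol v_{h,2}$ taken from within the element of $\mathcal T_2$). Set $\|\boldsymbol w\|_{\alpha,h,\Gamma}^2=\sum_{T\in\mathcal T_2}h_T^{-2\alpha}\|\boldsymbol w\|_{L^2(\Gamma\cap T)}^2$ and, for $\gamma>0$, $$a_h(\boldsymbol u_h,\boldsymbol v_h)=\sum_{i=1}^2(\nabla\boldsymbol u_{h,i},\nabla\boldsymbol v_{h,i})_{\Omega_i}-(\langle\partial_{\boldsymbol n}\boldsymbol u_h\rangle,[\boldsymbol v_h])_\Gamma-(\langle\partial_{\boldsymbol n}\boldsymbol v_h\rangle,[\boldsymbol u_h])_\Gamma+\gamma\sum_{T\in\mathcal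 T_2}h_T^{-1}([\boldsymbol u_h],[\boldsymbol v_h])_{\Gamma\cap T},$$ $$s_h(\boldsymbol u_h,\boldsymbol v_h)=(\nabla(\boldsymbol u_{h,1}-\boldsymbol u_{h,2}),\nabla(\boldsymbol v_{h,1}-\boldsymbol v_{h,2}))_{\Omega_O},$$ $$|||\boldsymbol v_h|||_*^2=\sum_{T\in\mathcal T_1^*}\|\nabla\boldsymbol v_{h,1}\|_T^2+\sum_{T\in\mathcal T_2}\|\nabla\boldsymbol v_{h,2}\|_T^2+\|\langle\partial_{\boldsymbol n}\boldsymbol v_h\rangle\|_{-1/2,h,\Gamma}^2+\|[\boldsymbol v_h]\|_{1/2,h,\Gamma}^2.$$ Then there is $\gamma_0>0$, depending only on $d$, $k$ and $\sigma$, such that for every $\gamma\ge\gamma_0$ there are constants $c>0$ and $C>0$, depending only on $d,k,\sigma,\gamma,\Omega_1,\Omega_2$ (and not on the meshes or the mesh sizes), such that $$a_h(\boldsymbol u_h,\boldsymbol v_h)+s_h(\boldsymbol u_h,\boldsymbol v_h)\le C\,|||\boldsymbol u_h|||_*\,|||\boldsymbol v_h|||_*\qquad\text{for all }\boldsymbol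 u_h,\boldsymbol v_h\in V_h,$$ $$c\,|||\boldsymbol v_h|||_*^2\le a_h(\boldsymbol v_h,\boldsymbol v_h)+s_h(\boldsymbol v_h,\boldsymbol v_h)\qquad\text{for all }\boldsymbol v_h\in V_h.$$ -/

import Mathlib

open MeasureTheory

namespace OverlapNitsche

/-- The Euclidean space `ℝ^d`. -/
abbrev Space (d : ℕ) : Type := EuclideanSpace ℝ (Fin d)

/-- The closed simplex spanned by a finite set of vertices. -/
abbrev simplex {d : ℕ} (T : Finset (Space d)) : Set (Space d) :=
  convexHull ℝ (T : Set (Space d))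

/-- The diameter `h_T` of an element. -/
noncomputable def meshSize {d : ℕ} (T : Finset (Space d)) : ℝ :=
  Metric.diam (simplex T)

/-- The closed region covered by a finite family of simplices. -/
def region {d : ℕ} (cells : Finset (Finset (Space d))) : Set (Space d) :=
  ⋃ T ∈ cells, simplex T

/-- A finite conforming mesh of nondegenerate `d`-simplices in `ℝ^d`, each element being
given by its `d + 1` vertices. -/
structure SimplicialMesh (d : ℕ) where
  cells : Finset (Finset (Space d))
  card_eq : ∀ T ∈ cells, T.card = d + 1
  affineIndependent : ∀ T ∈ cells, AffineIndependent ℝ (fun p : T => (p : Space d))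
  inter_eq : ∀ S ∈ cells, ∀ T ∈ cells,
    simplex S ∩ simplex T = convexHull ℝ ((S : Set (Space d)) ∩ (T : Set (Space d)))

/-- Shape regularity `h_T / ρ_T ≤ σ` for every element, where `ρ_T` is the diameter of the
largest ball contained in `T`: each `T` contains a ball of diameter `h_T / σ`. -/
def SimplicialMesh.ShapeRegular {d : ℕ} (M : SimplicialMesh d) (σ : ℝ) : Prop :=
  ∀ T ∈ M.cells, ∃ x : Space d, Metric.closedBall x (meshSize T / (2 * σ)) ⊆ simplex T

/-- Two disjoint bounded open subdomains whose boundaries are Lebesgue null sets (as is the case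
for Lipschitz boundaries). -/
structure IsDecomposition {d : ℕ} (Ω₁ Ω₂ : Set (Space d)) : Prop where
  isOpen₁ : IsOpen Ω₁
  isOpen₂ : IsOpen Ω₂
  isBounded₁ : Bornology.IsBounded Ω₁
  isBounded₂ : Bornology.IsBounded Ω₂
  disjoint : Disjoint Ω₁ Ω₂
  null₁ : volume (frontier Ω₁) = 0
  null₂ : volume (frontier Ω₂) = 0

/-- The whole domain `Ω`, the interior of the closure of `Ω₁ ∪ Ω₂`. -/
def wholeDomain {d : ℕ} (Ω₁ Ω₂ : Set (Space d)) : Set (Space d) :=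
  interior (closure (Ω₁ ∪ Ω₂))

/-- The interface `Γ`. -/
def interface {d : ℕ} (Ω₁ Ω₂ : Set (Space d)) : Set (Space d) :=
  frontier (closure Ω₁) ∩ frontier (closure Ω₂)

/-- A background mesh `T₀` of `Ω` and an overlapping mesh `T₂` of `Ω₂`. -/
structure OverlappingMeshes {d : ℕ} (Ω₁ Ω₂ : Set (Space d)) where
  T₀ : SimplicialMesh d
  T₂ : SimplicialMesh d
  region_T₀ : region T₀.cells = closure (wholeDomain Ω₁ Ω₂)
  region_T₂ : region T₂.cells = closure Ω₂

/-- `n` is the outward unit normal of the set `S` at the point `x` of a flat part of its boundary: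
near `x`, the set `S` is the half space on the side of `x` opposite to `n`. -/
def IsOuterNormal {d : ℕ} (S : Set (Space d)) (x n : Space d) : Prop :=
  ‖n‖ = 1 ∧ ∃ r > 0, ∀ y ∈ Metric.ball x r, y ∈ S ↔ inner ℝ (y - x) n ≤ 0

open Classical in
/-- The outward unit normal of `S`. For a polyhedral region it exists at all boundary points
outside a set of zero surface measure; the value there is irrelevant and set to zero. -/
noncomputable def outerNormal {d : ℕ} (S : Set (Space d)) (x : Space d) : Space d :=
  if h : ∃ n, IsOuterNormal S x n then h.choose else 0

/-- Continuous `ℝ^d`-valued vector fields on the region covered by `cells` whose components are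
polynomials of degree at most `k` on each element. The fields are represented by functions on
`ℝ^d` whose values outside the region are arbitrary and never used. -/
def feSpace {d : ℕ} (cells : Finset (Finset (Space d))) (k : ℕ) :
    Submodule ℝ (Space d → Space d) where
  carrier := {v | ContinuousOn v (region cells) ∧
    ∀ T ∈ cells, ∀ i : Fin d, ∃ p : MvPolynomial (Fin d) ℝ, p.totalDegree ≤ k ∧
      ∀ x ∈ simplex T, v x i = MvPolynomial.eval (fun j => x j) p}
  zero_mem' := ⟨continuousOn_const, fun _ _ _ => ⟨0, by simp, fun _ _ => by simp⟩⟩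
  add_mem' := by
    rintro u v ⟨hu, hu'⟩ ⟨hv, hv'⟩
    refine ⟨hu.add hv, fun T hT i => ?_⟩
    obtain ⟨p, hp, hpe⟩ := hu' T hT i
    obtain ⟨q, hq, hqe⟩ := hv' T hT i
    refine ⟨p + q, (MvPolynomial.totalDegree_add p q).trans (max_le hp hq), fun x hx => ?_⟩
    simp [hpe x hx, hqe x hx]
  smul_mem' := by
    rintro c v ⟨hv, hv'⟩
    refine ⟨hv.const_smul c, fun T hT i => ?_⟩
    obtain ⟨p, hp, hpe⟩ := hv' T hT i
    refine ⟨c • p, (MvPolynomial.totalDegree_smul_le c p).trans hp, fun x hx => ?_⟩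
    simp [hpe x hx, MvPolynomial.smul_eval]

/-- Frobenius inner product `A : B` of two gradients. -/
noncomputable def gradInner {d : ℕ} (A B : Space d →L[ℝ] Space d) : ℝ :=
  ∑ j : Fin d, inner ℝ (A (EuclideanSpace.single j 1)) (B (EuclideanSpace.single j 1))

/-- `(∇u, ∇v)_S`. The gradient of a continuous piecewise polynomial field is its classical
derivative, which exists outside the element boundaries. -/
noncomputable def dirichletForm {d : ℕ} (S : Set (Space d)) (u v : Space d → Space d) : ℝ :=
  ∫ x in S, gradInner (fderiv ℝ u x) (fderiv ℝ v x)

namespace OverlappingMeshes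

variable {d : ℕ} {Ω₁ Ω₂ : Set (Space d)} (M : OverlappingMeshes Ω₁ Ω₂)

open Classical in
/-- The mesh `T₁*`: the elements of the background mesh that are not completely overlapped. -/
noncomputable def T₁star : Finset (Finset (Space d)) :=
  M.T₀.cells.filter fun T =>
    simplex T ⊆ closure Ω₁ ∨ (0 < volume (simplex T ∩ Ω₁) ∧ 0 < volume (simplex T ∩ Ω₂))

/-- The overlap region `Ω_O = Ω₂ ∩ Ω₁*`. -/
noncomputable def overlap : Set (Space d) := Ω₂ ∩ region M.T₁star

/-- The composite velocity space `V_h = V_{h,1} ⊕ V_{h,2}` of order `k`. -/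
noncomputable def velocitySpace (k : ℕ) :
    Submodule ℝ ((Space d → Space d) × (Space d → Space d)) :=
  (feSpace M.T₁star k).prod (feSpace M.T₂.cells k)

/-- `(f, g)_Γ = ∑_{T ∈ T₂} ∫_{Γ ∩ T} f · g ds` for fields on `Γ` given element by element of the
mesh `T₂`; `μHE[d - 1]` is the surface measure. -/
noncomputable def interfaceInner (f g : Finset (Space d) → Space d → Space d) : ℝ :=
  ∑ T ∈ M.T₂.cells, ∫ x in interface Ω₁ Ω₂ ∩ simplex T, inner ℝ (f T x) (g T x) ∂μHE[d - 1]

/-- The squared interface norm `∑_{T ∈ T₂} h_T^{-2α} ‖f‖²_{Γ ∩ T}`. -/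
noncomputable def interfaceNormSq (α : ℝ) (f : Finset (Space d) → Space d → Space d) : ℝ :=
  ∑ T ∈ M.T₂.cells, meshSize T ^ (-2 * α) *
    ∫ x in interface Ω₁ Ω₂ ∩ simplex T, ‖f T x‖ ^ 2 ∂μHE[d - 1]

/-- The jump `[v] = v₂ - v₁` on the interface. -/
def jump (v : (Space d → Space d) × (Space d → Space d)) :
    Finset (Space d) → Space d → Space d :=
  fun _ x => v.2 x - v.1 x

/-- The mean `⟨∂_n v⟩ = ∂_n v₂` of the normal derivative on `Γ ∩ T`, taken from within the element
`T` of `T₂`; the normal points out of `Ω₂`, that is, from `Ω₂` into `Ω₁`. -/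
noncomputable def meanFlux (_M : OverlappingMeshes Ω₁ Ω₂)
    (v : (Space d → Space d) × (Space d → Space d)) :
    Finset (Space d) → Space d → Space d :=
  fun T x => fderivWithin ℝ v.2 (simplex T) x (outerNormal (closure Ω₂) x)

/-- The Nitsche form `a_h` with penalty parameter `γ`. -/
noncomputable def a (γ : ℝ) (u v : (Space d → Space d) × (Space d → Space d)) : ℝ :=
  dirichletForm Ω₁ u.1 v.1 + dirichletForm Ω₂ u.2 v.2
    - M.interfaceInner (M.meanFlux u) (jump v)
    - M.interfaceInner (M.meanFlux v) (jump u)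
    + γ * M.interfaceInner (fun T x => (meshSize T)⁻¹ • jump u T x) (jump v)

/-- The overlap penalty `s_h`. -/
noncomputable def s (u v : (Space d → Space d) × (Space d → Space d)) : ℝ :=
  dirichletForm M.overlap (u.1 - u.2) (v.1 - v.2)

/-- The norm `|||v|||_*`. -/
noncomputable def starNorm (v : (Space d → Space d) × (Space d → Space d)) : ℝ :=
  √((∑ T ∈ M.T₁star, dirichletForm (simplex T) v.1 v.1)
    + (∑ T ∈ M.T₂.cells, dirichletForm (simplex T) v.2 v.2)
    + M.interfaceNormSq (-1 / 2) (M.meanFlux v)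
    + M.interfaceNormSq (1 / 2) (jump v))

end OverlappingMeshes

end OverlapNitsche

/-! Coercivity. On the diagonal the form is the sum of the two Dirichlet energies, `s`, the jump
penalty, and minus twice the pairing of flux and jump. The flux is taken from `v.2` alone, and the
mesh `T₂` is fitted to `Ω₂`, so on `Γ` each flux is the boundary value of a polynomial on a whole
simplex, never on a cut piece of one. Hence the trace inverse inequality
`exists_trace_inverse_inequality` bounds the weighted flux norm by `C` times the energy of `v.2`,
with `C` depending on `d`, `k`, `σ` only. Young's inequality then absorbs the pairing into half of
that energy and part of the penalty, once `γ ≥ 2 * C + 1`.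

The norm also measures the gradient of `v.1` on the parts of cut elements outside `Ω₁`. Up to a null
set this is the overlap, where the gradient of `v.1` is the sum of the gradients of `v.1 - v.2` and
of `v.2`; the former is what `s` penalizes (`dirichletForm_region_T₁star_le`).

Boundedness is a weighted Cauchy-Schwarz inequality applied to each term with one common weight `t`;
minimizing the sum over `t` gives the product of norms (`le_mul_sqrt_mul_sqrt`).

The trace inequality needs no reference simplex. Polynomials of degree at most `k` form a
finite-dimensional space, so their values on a ball of radius `h` are controlled by the `L²` norm on
a concentric ball of radius `h * r` (`exists_inverse_inequality`). With the inscribed ball this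
bounds gradients pointwise, and it remains to bound the surface measure of the boundary of a simplex
by a multiple of `h ^ (d - 1)` (`exists_surfaceMeasure_frontier_le`). -/

namespace OverlapNitsche

/-! ### Inverse inequality for polynomials -/

lemma eval_eq_sum_Iic {d k : ℕ} (p : MvPolynomial (Fin d) ℝ) (hp : p.totalDegree ≤ k)
    (x : Fin d → ℝ) :
    MvPolynomial.eval x p =
      ∑ m ∈ Finset.Iic (Finsupp.equivFunOnFinite.symm fun _ : Fin d => k),
        p.coeff m * ∏ j, x j ^ m j := by
  rw [MvPolynomial.eval_eq']
  refine Finset.sum_subset (fun m hm => ?_) (fun m _ hm => ?_)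
  · rw [Finset.mem_Iic]
    intro i
    exact (MvPolynomial.monomial_le_degreeOf i hm).trans
      ((MvPolynomial.degreeOf_le_totalDegree p i).trans hp)
  · rw [MvPolynomial.notMem_support_iff.mp hm, zero_mul]

lemma continuous_eval_space {d : ℕ} (p : MvPolynomial (Fin d) ℝ) :
    Continuous fun x : Space d => MvPolynomial.eval (fun j => x j) p :=
  (MvPolynomial.continuous_eval p).comp (by fun_prop)

/-- The ball contains a product of intervals, and a polynomial vanishing on a product of infinite
sets is zero. -/
lemma eq_zero_of_eval_eq_zero_on_ball {d : ℕ} (p : MvPolynomial (Fin d) ℝ) {r : ℝ} (hr : 0 < r)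
    (h : ∀ x ∈ Metric.ball (0 : Space d) r, MvPolynomial.eval (fun j => x j) p = 0) : p = 0 := by
  have hcont : Continuous fun x : Fin d → ℝ => (WithLp.toLp 2 x : Space d) := by fun_prop
  have hopen : IsOpen ((fun x : Fin d → ℝ => (WithLp.toLp 2 x : Space d)) ⁻¹'
      Metric.ball 0 r) := Metric.isOpen_ball.preimage hcont
  obtain ⟨ε, hε, hsub⟩ := Metric.isOpen_iff.mp hopen 0 (by simp [hr])
  refine MvPolynomial.funext_set (fun _ => Metric.ball (0 : ℝ) ε) (fun _ => ?_) fun x hx => ?_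
  · rw [Real.ball_eq_Ioo]
    exact Set.Ioo_infinite (by linarith)
  · rw [map_zero]
    refine h (WithLp.toLp 2 x) (hsub ?_)
    rw [ball_pi _ hε]
    simpa using hx

lemma integral_sq_eval_pos {d : ℕ} (p : MvPolynomial (Fin d) ℝ) (hp : p ≠ 0) {r : ℝ}
    (hr : 0 < r) :
    0 < ∫ x in Metric.closedBall (0 : Space d) r, MvPolynomial.eval (fun j => x j) p ^ 2 := by
  have hc := (continuous_eval_space p).pow 2
  have h0 : 0 ≤ ∫ x in Metric.closedBall (0 : Space d) r,
      MvPolynomial.eval (fun j => x j) p ^ 2 := integral_nonneg fun x => sq_nonneg _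
  refine lt_of_le_of_ne h0 fun heq => hp ?_
  rw [eq_comm, integral_eq_zero_iff_of_nonneg (fun x => sq_nonneg _)
    (hc.continuousOn.integrableOn_compact (isCompact_closedBall _ _))] at heq
  have h1 : (fun x : Space d => MvPolynomial.eval (fun j => x j) p ^ 2)
      =ᵐ[volume.restrict (Metric.ball 0 r)] fun _ => (0 : ℝ) :=
    ae_restrict_of_ae_restrict_of_subset Metric.ball_subset_closedBall heq
  have h2 := Measure.eqOn_open_of_ae_eq h1 Metric.isOpen_ball hc.continuousOn continuousOn_const
  exact eq_zero_of_eval_eq_zero_on_ball p hr fun x hx => by simpa using h2 hx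

/-- Equivalence of norms in finite dimension: the `L²` norm on the small ball is positive on the
compact unit sphere of coefficient vectors, so by homogeneity it dominates the largest coefficient,
which in turn dominates the values on the unit ball. -/
lemma exists_sq_eval_le_integral (d k : ℕ) {r : ℝ} (hr : 0 < r) :
    ∃ C : ℝ, 0 < C ∧ ∀ p : MvPolynomial (Fin d) ℝ, p.totalDegree ≤ k →
      ∀ z ∈ Metric.closedBall (0 : Space d) 1, MvPolynomial.eval (fun j => z j) p ^ 2 ≤
        C * ∫ x in Metric.closedBall (0 : Space d) r, MvPolynomial.eval (fun j => x j) p ^ 2 := by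
  set s : Finset (Fin d →₀ ℕ) := Finset.Iic (Finsupp.equivFunOnFinite.symm fun _ => k) with hs
  let P : (s → ℝ) → MvPolynomial (Fin d) ℝ := fun c => ∑ m : s, MvPolynomial.monomial m.1 (c m)
  have hPeval : ∀ c x, MvPolynomial.eval x (P c) = ∑ m : s, c m * ∏ j, x j ^ m.1 j := by
    intro c x
    simp [P, map_sum, MvPolynomial.eval_monomial, Finsupp.prod_fintype]
  have hPcoeff : ∀ c (m : s), (P c).coeff m.1 = c m := by
    intro c m
    simp only [P, MvPolynomial.coeff_sum, MvPolynomial.coeff_monomial]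
    rw [Finset.sum_eq_single m]
    · simp
    · intro b _ hb
      rw [if_neg fun h => hb (Subtype.ext h)]
    · simp
  have hcont : Continuous fun c : s → ℝ => ∫ x in Metric.closedBall (0 : Space d) r,
      MvPolynomial.eval (fun j => x j) (P c) ^ 2 := by
    refine continuous_parametric_integral_of_continuous ?_ (isCompact_closedBall _ _)
    simp only [Function.uncurry_def, hPeval]
    fun_prop
  have hhom : ∀ (t : ℝ) (c : s → ℝ) (x : Space d), MvPolynomial.eval (fun j => x j) (P (t • c)) =
      t * MvPolynomial.eval (fun j => x j) (P c) := by
    intro t c x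
    simp [hPeval, Finset.mul_sum, mul_assoc]
  obtain ⟨C₀, hC₀, hbound⟩ : ∃ C₀ : ℝ, 0 < C₀ ∧ ∀ c : s → ℝ, C₀ * ‖c‖ ^ 2 ≤
      ∫ x in Metric.closedBall (0 : Space d) r, MvPolynomial.eval (fun j => x j) (P c) ^ 2 := by
    have key : ∃ C₀ : ℝ, 0 < C₀ ∧ ∀ c ∈ Metric.sphere (0 : s → ℝ) 1, C₀ ≤
        ∫ x in Metric.closedBall (0 : Space d) r,
          MvPolynomial.eval (fun j => x j) (P c) ^ 2 := by
      rcases (Metric.sphere (0 : s → ℝ) 1).eq_empty_or_nonempty with he | hne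
      · exact ⟨1, one_pos, by simp [he]⟩
      · obtain ⟨c₀, hc₀, hmin⟩ := (isCompact_sphere (0 : s → ℝ) 1).exists_isMinOn hne
          hcont.continuousOn
        refine ⟨_, integral_sq_eval_pos (P c₀) (fun h0 => ?_) hr, fun c hc => hmin hc⟩
        have : c₀ = 0 := by
          funext m
          rw [← hPcoeff c₀ m, h0]
          simp
        simp [this] at hc₀
    obtain ⟨C₀, hC₀, h⟩ := key
    refine ⟨C₀, hC₀, fun c => ?_⟩
    rcases eq_or_ne c 0 with rfl | hc
    · simpa using integral_nonneg fun x => sq_nonneg _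
    · have hn : 0 < ‖c‖ := norm_pos_iff.mpr hc
      have h1 := h (‖c‖⁻¹ • c) (by simp [norm_smul, hn.ne'])
      simp only [hhom, mul_pow, integral_const_mul] at h1
      rw [inv_pow, inv_mul_eq_div, le_div_iff₀ (by positivity)] at h1
      exact h1
  -- Every monomial is at most 1 in modulus on the unit ball, so a value is at most the number of
  -- monomials times the largest coefficient; the added 1 makes positivity of the constant
  -- immediate.
  refine ⟨(s.card + 1 : ℝ) ^ 2 / C₀, by positivity, fun p hp z hz => ?_⟩
  set c : s → ℝ := fun m => p.coeff m.1 with hc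
  have hpc : ∀ x, MvPolynomial.eval x p = MvPolynomial.eval x (P c) := by
    intro x
    rw [hPeval, eval_eq_sum_Iic p hp, ← hs, ← Finset.sum_coe_sort]
  have hz1 : ∀ j, |z j| ≤ 1 := fun j => by
    have h2 : ‖z j‖ ≤ ‖z‖ := PiLp.norm_apply_le z j
    rw [Real.norm_eq_abs] at h2
    exact h2.trans (by simpa using hz)
  have h1 : |MvPolynomial.eval (fun j => z j) p| ≤ (s.card + 1) * ‖c‖ := by
    rw [hpc, hPeval]
    calc |∑ m : s, c m * ∏ j, z j ^ m.1 j| ≤ ∑ m : s, |c m * ∏ j, z j ^ m.1 j| :=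
          Finset.abs_sum_le_sum_abs _ _
      _ ≤ ∑ _m : s, ‖c‖ := by
          refine Finset.sum_le_sum fun m _ => ?_
          rw [abs_mul, Finset.abs_prod]
          have h3 : ∏ j, |z j ^ m.1 j| ≤ 1 := Finset.prod_le_one (fun _ _ => abs_nonneg _)
            fun j _ => by rw [abs_pow]; exact pow_le_one₀ (abs_nonneg _) (hz1 j)
          calc |c m| * ∏ j, |z j ^ m.1 j| ≤ ‖c‖ * 1 :=
                mul_le_mul (norm_le_pi_norm c m) h3
                  (Finset.prod_nonneg fun _ _ => abs_nonneg _) (norm_nonneg _)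
            _ = ‖c‖ := mul_one _
      _ = s.card * ‖c‖ := by simp
      _ ≤ (s.card + 1) * ‖c‖ := by nlinarith [norm_nonneg c]
  calc MvPolynomial.eval (fun j => z j) p ^ 2 ≤ ((s.card + 1) * ‖c‖) ^ 2 := by
        rw [← sq_abs]
        exact pow_le_pow_left₀ (abs_nonneg _) h1 2
    _ = (s.card + 1 : ℝ) ^ 2 / C₀ * (C₀ * ‖c‖ ^ 2) := by field_simp
    _ ≤ _ := by
        simp only [hpc]
        exact mul_le_mul_of_nonneg_left (hbound c) (by positivity)

/-- Substituting polynomials of degree at most one for the variables does not raise the degree. -/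
lemma exists_eval_affine {d k : ℕ} (p : MvPolynomial (Fin d) ℝ) (hp : p.totalDegree ≤ k)
    (a : Space d) (t : ℝ) : ∃ q : MvPolynomial (Fin d) ℝ, q.totalDegree ≤ k ∧
      ∀ z : Space d, MvPolynomial.eval (fun j => z j) q =
        MvPolynomial.eval (fun j => (a + t • z) j) p := by
  let L : Fin d → MvPolynomial (Fin d) ℝ := fun j =>
    MvPolynomial.C (a j) + MvPolynomial.C t * MvPolynomial.X j
  have hL : ∀ j, (L j).totalDegree ≤ 1 := fun j => by
    refine (MvPolynomial.totalDegree_add _ _).trans (max_le (by simp) ?_)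
    refine (MvPolynomial.totalDegree_mul _ _).trans ?_
    simp
  refine ⟨∑ m ∈ p.support, MvPolynomial.C (p.coeff m) * ∏ j, L j ^ m j, ?_, fun z => ?_⟩
  · refine (MvPolynomial.totalDegree_finsetSum _ _).trans (Finset.sup_le fun m hm => ?_)
    refine (MvPolynomial.totalDegree_mul _ _).trans ?_
    rw [MvPolynomial.totalDegree_C, zero_add]
    refine (MvPolynomial.totalDegree_finsetProd _ _).trans ?_
    have h1 : ∑ j, m j ≤ k := by
      refine le_trans (le_of_eq ?_) ((MvPolynomial.le_totalDegree hm).trans hp)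
      rw [Finsupp.sum_fintype _ _ fun _ => rfl]
    refine (Finset.sum_le_sum fun j _ => ?_).trans h1
    refine (MvPolynomial.totalDegree_pow _ _).trans ?_
    simpa using Nat.mul_le_mul_left (m j) (hL j)
  · rw [MvPolynomial.eval_eq' _ p]
    simp [L, map_sum, map_prod]

/-- Scaling of the unit ball estimate by `x = a + h • z`; the Jacobian is the factor `h ^ d`. -/
lemma exists_inverse_inequality (d k : ℕ) {r : ℝ} (hr : 0 < r) :
    ∃ C : ℝ, 0 < C ∧ ∀ p : MvPolynomial (Fin d) ℝ, p.totalDegree ≤ k →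
      ∀ (a : Space d) (h : ℝ), 0 < h → ∀ y ∈ Metric.closedBall a h,
        h ^ d * MvPolynomial.eval (fun j => y j) p ^ 2 ≤
          C * ∫ x in Metric.closedBall a (h * r), MvPolynomial.eval (fun j => x j) p ^ 2 := by
  obtain ⟨C, hC, hb⟩ := exists_sq_eval_le_integral d k hr
  refine ⟨C, hC, fun p hp a h hh y hy => ?_⟩
  obtain ⟨q, hq, hqe⟩ := exists_eval_affine p hp a h
  have hz : h⁻¹ • (y - a) ∈ Metric.closedBall (0 : Space d) 1 := by
    rw [mem_closedBall_zero_iff, norm_smul, norm_inv, Real.norm_of_nonneg hh.le,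
      inv_mul_le_iff₀ hh, mul_one, ← dist_eq_norm]
    exact hy
  have h1 := hb q hq _ hz
  rw [hqe, smul_inv_smul₀ hh.ne', add_sub_cancel] at h1
  have h2 : ∫ x in Metric.closedBall (0 : Space d) r, MvPolynomial.eval (fun j => x j) q ^ 2 =
      (h ^ d)⁻¹ * ∫ x in Metric.closedBall a (h * r),
        MvPolynomial.eval (fun j => x j) p ^ 2 := by
    have h3 := Measure.setIntegral_comp_smul_of_pos (volume : Measure (Space d))
      (fun x => MvPolynomial.eval (fun j => (a + x) j) p ^ 2) (Metric.closedBall 0 r) hh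
    simp only [finrank_euclideanSpace_fin, smul_eq_mul] at h3
    simp only [hqe]
    rw [h3, smul_closedBall _ _ hr.le, smul_zero, Real.norm_of_nonneg hh.le]
    congr 1
    have h4 := (measurePreserving_add_left (volume : Measure (Space d)) a).setIntegral_preimage_emb
      (measurableEmbedding_addLeft a) (fun x => MvPolynomial.eval (fun j => x j) p ^ 2)
      (Metric.closedBall a (h * r))
    rw [← h4]
    simp
  rw [h2] at h1
  calc h ^ d * MvPolynomial.eval (fun j => y j) p ^ 2 ≤ h ^ d * (C * ((h ^ d)⁻¹ *
        ∫ x in Metric.closedBall a (h * r), MvPolynomial.eval (fun j => x j) p ^ 2)) :=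
        mul_le_mul_of_nonneg_left h1 (by positivity)
    _ = _ := by field_simp

/-! ### Simplices -/

lemma isCompact_simplex {d : ℕ} (T : Finset (Space d)) : IsCompact (simplex T) :=
  Set.Finite.isCompact_convexHull ℝ T.finite_toSet

lemma measurableSet_simplex {d : ℕ} (T : Finset (Space d)) : MeasurableSet (simplex T) :=
  (isCompact_simplex T).measurableSet

lemma dist_le_meshSize {d : ℕ} {T : Finset (Space d)} {x y : Space d} (hx : x ∈ simplex T)
    (hy : y ∈ simplex T) : dist x y ≤ meshSize T :=
  Metric.dist_le_diam_of_mem (isCompact_simplex T).isBounded hx hy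

lemma meshSize_nonneg {d : ℕ} (T : Finset (Space d)) : 0 ≤ meshSize T := Metric.diam_nonneg

lemma meshSize_pos {d : ℕ} {T : Finset (Space d)} (hT : 1 < T.card) : 0 < meshSize T := by
  obtain ⟨x, hx, y, hy, hxy⟩ := Finset.one_lt_card.mp hT
  exact (dist_pos.mpr hxy).trans_le
    (dist_le_meshSize (subset_convexHull ℝ _ hx) (subset_convexHull ℝ _ hy))

lemma volume_frontier_simplex {d : ℕ} (T : Finset (Space d)) :
    volume (frontier (simplex T)) = 0 :=
  (convex_convexHull ℝ _).addHaar_frontier volume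

lemma affineSpan_eq_top_of_card {d : ℕ} {T : Finset (Space d)} (hc : T.card = d + 1)
    (hT : AffineIndependent ℝ (fun p : T => (p : Space d))) :
    affineSpan ℝ (Set.range fun p : T => (p : Space d)) = ⊤ := by
  rw [hT.affineSpan_eq_top_iff_card_eq_finrank_add_one]
  simp [hc]

lemma interior_simplex_nonempty {d : ℕ} {T : Finset (Space d)} (hc : T.card = d + 1)
    (hT : AffineIndependent ℝ (fun p : T => (p : Space d))) :
    (interior (simplex T)).Nonempty := by
  rw [interior_convexHull_nonempty_iff_affineSpan_eq_top]
  simpa using affineSpan_eq_top_of_card hc hT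

open Classical in
lemma volume_simplex_erase {d : ℕ} {T : Finset (Space d)}
    (hT : AffineIndependent ℝ (fun p : T => (p : Space d))) {p : Space d} (hp : p ∈ T) :
    volume (simplex (T.erase p)) = 0 := by
  refine measure_mono_null (convexHull_subset_affineSpan _)
    (Measure.addHaar_affineSubspace volume _ fun htop => ?_)
  refine hT.notMem_affineSpan_sdiff ⟨p, hp⟩ Set.univ ?_
  have h : (fun q : T => (q : Space d)) '' (Set.univ \ {⟨p, hp⟩}) = (T.erase p : Finset _) := by
    ext x
    simp only [Set.mem_image, Set.mem_sdiff, Set.mem_univ, true_and, Set.mem_singleton_iff,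
      Finset.coe_erase, Finset.mem_coe]
    constructor
    · rintro ⟨q, hq, rfl⟩
      exact ⟨q.2, fun h => hq (Subtype.ext h)⟩
    · rintro ⟨hx, hne⟩
      exact ⟨⟨x, hx⟩, fun h => hne (congrArg Subtype.val h), rfl⟩
  rw [h, htop]
  trivial

-- A boundary point has a vanishing barycentric coordinate, hence lies in the face opposite to that
-- vertex.
open Classical in
lemma frontier_simplex_subset {d : ℕ} {T : Finset (Space d)} (hc : T.card = d + 1)
    (hT : AffineIndependent ℝ (fun p : T => (p : Space d))) :
    frontier (simplex T) ⊆ ⋃ p ∈ T, simplex (T.erase p) := by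
  let b : AffineBasis T ℝ (Space d) := ⟨fun p => p, hT, affineSpan_eq_top_of_card hc hT⟩
  have hb : simplex T = convexHull ℝ (Set.range b) := by
    have h : Set.range b = (T : Set (Space d)) := Subtype.range_coe
    rw [h]
  intro x hx
  have hxT : x ∈ convexHull ℝ (Set.range b) :=
    hb ▸ (isCompact_simplex T).isClosed.frontier_subset hx
  have hxi : x ∉ interior (convexHull ℝ (Set.range b)) := hb ▸ hx.2
  have hnn := hxT
  rw [b.convexHull_eq_nonneg_coord] at hnn
  rw [b.interior_convexHull] at hxi
  obtain ⟨i, hi⟩ := not_forall.mp hxi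
  have hi0 : b.coord i x = 0 := le_antisymm (not_lt.mp hi) (hnn i)
  refine Set.mem_iUnion₂.mpr ⟨i, i.2, ?_⟩
  have hsum : ∑ j ∈ Finset.univ.erase i, b.coord j x • b j = x := by
    have h := b.linear_combination_coord_eq_self x
    rw [← Finset.sum_erase_add _ _ (Finset.mem_univ i), hi0, zero_smul, add_zero] at h
    exact h
  have hone : ∑ j ∈ Finset.univ.erase i, b.coord j x = 1 := by
    have h := b.sum_coord_apply_eq_one x
    rwa [← Finset.sum_erase_add _ _ (Finset.mem_univ i), hi0, add_zero] at h
  rw [← hsum]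
  refine (convex_convexHull ℝ _).sum_mem (fun j _ => hnn j) hone fun j hj => ?_
  refine subset_convexHull ℝ _ ?_
  rw [Finset.coe_erase]
  exact ⟨j.2, fun h => Finset.ne_of_mem_erase hj (Subtype.ext h)⟩

-- The hull lies in the image of the unit cube under `t ↦ p + ∑ q, t q • (q - p)`, which is
-- Lipschitz with constant `m * h` for the sup norm, and the cube has measure 1.
open Classical in
lemma hausdorffMeasure_convexHull_le {d m : ℕ} {S : Finset (Space d)} (hS : S.card = m + 1)
    {h : ℝ} (hd : ∀ x ∈ S, ∀ y ∈ S, dist x y ≤ h) :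
    Measure.hausdorffMeasure (m : ℝ) (convexHull ℝ (S : Set (Space d))) ≤
      ENNReal.ofReal ((m * h) ^ m) := by
  obtain ⟨p, hp⟩ : S.Nonempty := Finset.card_pos.mp (by omega)
  have hh : 0 ≤ h := dist_self p ▸ hd p hp p hp
  have hcard : Fintype.card (S.erase p) = m := by
    rw [Fintype.card_coe, Finset.card_erase_of_mem hp, hS, Nat.add_sub_cancel]
  let f : (S.erase p → ℝ) → Space d := fun t => p + ∑ q, t q • ((q : Space d) - p)
  have hlip : LipschitzWith (Real.toNNReal (m * h)) f := by
    refine LipschitzWith.of_dist_le_mul fun s t => ?_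
    rw [Real.coe_toNNReal _ (by positivity)]
    calc dist (f s) (f t) = ‖∑ q, (s q - t q) • ((q : Space d) - p)‖ := by
          simp only [f, sub_smul, Finset.sum_sub_distrib, dist_eq_norm,
            add_sub_add_left_eq_sub]
      _ ≤ ∑ q : S.erase p, dist s t * h := by
          refine (norm_sum_le _ _).trans (Finset.sum_le_sum fun q _ => ?_)
          rw [norm_smul, ← dist_eq_norm, ← dist_eq_norm]
          exact mul_le_mul (dist_le_pi_dist s t q) (hd _ (Finset.mem_of_mem_erase q.2) _ hp)
            dist_nonneg dist_nonneg
      _ = m * h * dist s t := by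
          rw [Finset.sum_const, Finset.card_univ, hcard, nsmul_eq_mul]
          ring
  have hsub : convexHull ℝ (S : Set (Space d)) ⊆ f '' Set.Icc 0 1 := by
    intro x hx
    obtain ⟨w, hw, hw1, rfl⟩ := Finset.mem_convexHull'.mp hx
    have h1 : ∑ q : S.erase p, w q = 1 - w p := by
      rw [Finset.sum_coe_sort (S.erase p) w, ← hw1, ← Finset.sum_erase_add _ _ hp]
      ring
    refine ⟨fun q => w q, ⟨fun q => hw _ (Finset.mem_of_mem_erase q.2), fun q => ?_⟩, ?_⟩
    · rw [Pi.one_apply, ← hw1]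
      exact Finset.single_le_sum (fun i hi => hw i hi) (Finset.mem_of_mem_erase q.2)
    · simp only [f, smul_sub, Finset.sum_sub_distrib, ← Finset.sum_smul, h1]
      rw [Finset.sum_coe_sort (S.erase p) fun q => w q • q, ← Finset.sum_erase_add S _ hp,
        sub_smul, one_smul]
      abel
  calc Measure.hausdorffMeasure (m : ℝ) (convexHull ℝ (S : Set (Space d)))
      ≤ Measure.hausdorffMeasure (m : ℝ) (f '' Set.Icc 0 1) := measure_mono hsub
    _ ≤ (Real.toNNReal (m * h) : ENNReal) ^ (m : ℝ) *
          Measure.hausdorffMeasure (m : ℝ) (Set.Icc (0 : S.erase p → ℝ) 1) :=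
        (hlip.lipschitzOnWith (s := Set.Icc 0 1)).hausdorffMeasure_image_le (Nat.cast_nonneg m)
    _ = ENNReal.ofReal ((m * h) ^ m) := by
        have hv : Measure.hausdorffMeasure (m : ℝ) (Set.Icc (0 : S.erase p → ℝ) 1) = 1 := by
          have := congrArg (fun μ => μ (Set.Icc (0 : S.erase p → ℝ) 1))
            (hausdorffMeasure_pi_real (ι := S.erase p))
          simp only [hcard] at this
          rw [this, Real.volume_Icc_pi]
          simp
        rw [hv, mul_one, ENNReal.rpow_natCast, ENNReal.ofReal_pow (by positivity)]
        rfl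

lemma exists_surfaceMeasure_frontier_le (d : ℕ) (hd : 1 ≤ d) :
    ∃ C : ℝ, 0 < C ∧ ∀ T : Finset (Space d), T.card = d + 1 →
      AffineIndependent ℝ (fun p : T => (p : Space d)) →
      μHE[d - 1] (frontier (simplex T)) ≤ ENNReal.ofReal (C * meshSize T ^ (d - 1)) := by
  classical
  set κ := Measure.addHaarScalarFactor (volume : Measure (EuclideanSpace ℝ (Fin (d - 1))))
    (Measure.hausdorffMeasure ((d - 1 : ℕ) : ℝ)) with hκ
  -- `κ` converts Hausdorff measure to its Euclidean normalization, `d + 1` counts the faces, and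
  -- the final 1 only secures positivity.
  refine ⟨κ * (d + 1) * ((d - 1 : ℕ) : ℝ) ^ (d - 1) + 1, by positivity, fun T hc hT => ?_⟩
  have h1 : Measure.hausdorffMeasure ((d - 1 : ℕ) : ℝ) (frontier (simplex T)) ≤
      ∑ _p ∈ T, ENNReal.ofReal ((((d - 1 : ℕ) : ℝ) * meshSize T) ^ (d - 1)) := by
    refine (measure_mono (frontier_simplex_subset hc hT)).trans
      ((measure_biUnion_finset_le _ _).trans (Finset.sum_le_sum fun p hp => ?_))
    refine hausdorffMeasure_convexHull_le ?_ fun x hx y hy => ?_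
    · rw [Finset.card_erase_of_mem hp, hc]
      omega
    · exact dist_le_meshSize (subset_convexHull ℝ _ (Finset.mem_of_mem_erase hx))
        (subset_convexHull ℝ _ (Finset.mem_of_mem_erase hy))
  have hh := meshSize_nonneg T
  rw [Finset.sum_const, hc, nsmul_eq_mul, ← ENNReal.ofReal_natCast,
    ← ENNReal.ofReal_mul (by positivity)] at h1
  rw [Measure.euclideanHausdorffMeasure_def, Measure.smul_apply, ← hκ, ENNReal.smul_def,
    smul_eq_mul, ← ENNReal.ofReal_coe_nnreal]
  refine (mul_le_mul_right h1 _).trans ?_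
  rw [← ENNReal.ofReal_mul (by positivity)]
  refine ENNReal.ofReal_le_ofReal ?_
  have : 0 ≤ meshSize T ^ (d - 1) := by positivity
  rw [mul_pow]
  push_cast
  nlinarith

/-! ### Meshes -/

lemma isCompact_region {d : ℕ} (cells : Finset (Finset (Space d))) : IsCompact (region cells) :=
  cells.isCompact_biUnion fun T _ => isCompact_simplex T

lemma simplex_subset_region {d : ℕ} {cells : Finset (Finset (Space d))} {T : Finset (Space d)}
    (hT : T ∈ cells) : simplex T ⊆ region cells :=
  Set.subset_biUnion_of_mem (u := fun T => simplex T) hT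

/-- By conformity the intersection lies in the face of `S` opposite to a vertex that `T` does not
have. -/
lemma SimplicialMesh.volume_inter {d : ℕ} (M : SimplicialMesh d) {S T : Finset (Space d)}
    (hS : S ∈ M.cells) (hT : T ∈ M.cells) (hne : S ≠ T) :
    volume (simplex S ∩ simplex T) = 0 := by
  classical
  obtain ⟨p, hpS, hpT⟩ : ∃ p ∈ S, p ∉ T := by
    by_contra! h
    exact hne (Finset.eq_of_subset_of_card_le h (by rw [M.card_eq S hS, M.card_eq T hT]))
  refine measure_mono_null ?_ (volume_simplex_erase (M.affineIndependent S hS) hpS)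
  rw [M.inter_eq S hS T hT]
  refine convexHull_mono fun x hx => ?_
  rw [Finset.coe_erase]
  exact ⟨hx.1, fun h => hpT (h ▸ hx.2)⟩

lemma SimplicialMesh.integral_region {d : ℕ} (M : SimplicialMesh d)
    {cells : Finset (Finset (Space d))} (hsub : cells ⊆ M.cells) {f : Space d → ℝ}
    (hf : ∀ T ∈ cells, IntegrableOn f (simplex T)) :
    ∫ x in region cells, f x = ∑ T ∈ cells, ∫ x in simplex T, f x := by
  have hreg : region cells = ⋃ T : cells, simplex T.1 := by
    ext x
    simp [region]
  rw [hreg, integral_iUnion_ae (fun T => (measurableSet_simplex _).nullMeasurableSet)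
    (fun S T hne => M.volume_inter (hsub S.2) (hsub T.2) fun h => hne (Subtype.ext h))
    (by rw [integrableOn_finite_iUnion]; exact fun T => hf T T.2), tsum_fintype,
    Finset.sum_coe_sort cells fun T => ∫ x in simplex T, f x]

lemma integrableOn_region {d : ℕ} {cells : Finset (Finset (Space d))} {f : Space d → ℝ}
    (hf : ∀ T ∈ cells, IntegrableOn f (simplex T)) : IntegrableOn f (region cells) := by
  rw [region, integrableOn_finset_iUnion]
  exact hf

/-- Almost every point of the covered region is an interior point of some element. -/
lemma ae_mem_interior_of_mem_region {d : ℕ} (cells : Finset (Finset (Space d))) :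
    ∀ᵐ x : Space d, x ∈ region cells → ∃ T ∈ cells, x ∈ interior (simplex T) := by
  have h : ∀ᵐ x : Space d, ∀ T ∈ cells, x ∉ frontier (simplex T) := by
    rw [Filter.eventually_all_finset]
    exact fun T _ => measure_eq_zero_iff_ae_notMem.mp (volume_frontier_simplex T)
  filter_upwards [h] with x hx hxr
  obtain ⟨T, hT, hxT⟩ := Set.mem_iUnion₂.mp hxr
  refine ⟨T, hT, ?_⟩
  by_contra hni
  exact hx T hT ⟨subset_closure hxT, hni⟩

/-! ### The outer normal -/

lemma IsOuterNormal.of_mem_hyperplane {d : ℕ} {S : Set (Space d)} {x n : Space d} {r : ℝ}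
    (hn : ‖n‖ = 1) (h : ∀ y ∈ Metric.ball x r, y ∈ S ↔ inner ℝ (y - x) n ≤ 0) {y : Space d}
    (hy : y ∈ Metric.ball x r) (hyn : inner ℝ (y - x) n = 0) : IsOuterNormal S y n := by
  obtain ⟨ε, hε, hsub⟩ := Metric.isOpen_iff.mp Metric.isOpen_ball y hy
  refine ⟨hn, ε, hε, fun z hz => ?_⟩
  rw [h z (hsub hz), ← sub_add_sub_cancel z y x, inner_add_left, hyn, add_zero]

/-- Both half spaces agree with `S` near `x`, so by scaling one is contained in the other. Testing
with `m - n` forces equality in the Cauchy-Schwarz inequality. -/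
lemma IsOuterNormal.unique {d : ℕ} {S : Set (Space d)} {x n m : Space d}
    (hn : IsOuterNormal S x n) (hm : IsOuterNormal S x m) : n = m := by
  obtain ⟨hn1, r, hr, hrn⟩ := hn
  obtain ⟨hm1, s, hs, hsm⟩ := hm
  have key : ∀ v : Space d, inner ℝ v n ≤ 0 → inner ℝ v m ≤ 0 := by
    intro v hv
    set t : ℝ := min r s / (2 * (‖v‖ + 1)) with ht
    have hmin : 0 < min r s := lt_min hr hs
    have htpos : 0 < t := by positivity
    have hlt : ‖t • v‖ < min r s := by
      rw [norm_smul, Real.norm_of_nonneg htpos.le, ht, div_mul_eq_mul_div, div_lt_iff₀ (by positivity)]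
      nlinarith [norm_nonneg v]
    have h1 : x + t • v ∈ Metric.ball x r := by
      simpa using hlt.trans_le (min_le_left _ _)
    have h2 : x + t • v ∈ Metric.ball x s := by
      simpa using hlt.trans_le (min_le_right _ _)
    have h3 := (hrn _ h1).mpr (by
      rw [add_sub_cancel_left, real_inner_smul_left]
      exact mul_nonpos_of_nonneg_of_nonpos htpos.le hv)
    have h4 := (hsm _ h2).mp h3
    rw [add_sub_cancel_left, real_inner_smul_left] at h4
    exact nonpos_of_mul_nonpos_right h4 htpos
  have h2 := key (m - n) (by
    have h : inner ℝ m n ≤ 1 := by simpa [hn1, hm1] using real_inner_le_norm m n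
    rw [inner_sub_left, real_inner_self_eq_norm_sq, hn1]
    linarith)
  rw [inner_sub_left, real_inner_self_eq_norm_sq, hm1] at h2
  have h1 : inner ℝ n m ≤ 1 := by simpa [hn1, hm1] using real_inner_le_norm n m
  exact (inner_eq_one_iff_of_norm_eq_one (𝕜 := ℝ) hn1 hm1).mp (by linarith)

/-- If the inner product were negative, `y` would be interior to `S`, but moving from `y` along its
own normal leaves `S` at once. -/
lemma IsOuterNormal.inner_eq_zero {d : ℕ} {S : Set (Space d)} {x n y m : Space d} {r : ℝ}
    (h : ∀ y ∈ Metric.ball x r, y ∈ S ↔ inner ℝ (y - x) n ≤ 0)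
    (hy : y ∈ Metric.ball x r) (hm : IsOuterNormal S y m) : inner ℝ (y - x) n = 0 := by
  obtain ⟨hm1, s, hs, hsm⟩ := hm
  refine le_antisymm ((h y hy).mp ((hsm y (Metric.mem_ball_self hs)).mpr (by simp))) ?_
  by_contra! hlt
  have hc : Filter.Tendsto (fun t : ℝ => y + t • m) (nhds 0) (nhds y) := by
    have : Continuous fun t : ℝ => y + t • m := by fun_prop
    simpa using this.tendsto 0
  have hopen : IsOpen {z : Space d | inner ℝ (z - x) n < 0} :=
    isOpen_lt (by fun_prop) continuous_const
  have hev : ∀ᶠ t in nhds (0 : ℝ), y + t • m ∈ S := by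
    filter_upwards [hc (Metric.isOpen_ball.mem_nhds hy), hc (hopen.mem_nhds hlt)] with t h1 h2
    exact (h _ h1).mpr (le_of_lt h2)
  have hev2 : ∀ᶠ t in nhds (0 : ℝ), t ≤ 0 := by
    filter_upwards [hev, hc (Metric.ball_mem_nhds y hs)] with t h1 h2
    have := (hsm _ h2).mp h1
    rw [add_sub_cancel_left, real_inner_smul_left, real_inner_self_eq_norm_sq, hm1] at this
    linarith
  obtain ⟨ε, hε, hball⟩ := Metric.eventually_nhds_iff.mp hev2
  have := hball (y := ε / 2) (by rw [Real.dist_eq, sub_zero, abs_of_pos (by linarith)]; linarith)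
  linarith

lemma outerNormal_eq {d : ℕ} {S : Set (Space d)} {x n : Space d} (h : IsOuterNormal S x n) :
    outerNormal S x = n := by
  have hex : ∃ n, IsOuterNormal S x n := ⟨n, h⟩
  rw [outerNormal, dif_pos hex]
  exact hex.choose_spec.unique h

lemma norm_outerNormal_le {d : ℕ} (S : Set (Space d)) (x : Space d) :
    ‖outerNormal S x‖ ≤ 1 := by
  by_cases h : ∃ n, IsOuterNormal S x n
  · obtain ⟨n, hn⟩ := h
    rw [outerNormal_eq hn, hn.1]
  · rw [outerNormal, dif_neg h, norm_zero]
    exact zero_le_one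

/-- Near a point with a normal, the points with a normal are exactly those of a hyperplane. This
serves the measurability of `outerNormal`, which is locally constant on this set. -/
lemma isLocallyClosed_setOf_isOuterNormal {d : ℕ} (S : Set (Space d)) :
    IsLocallyClosed {x | ∃ n, IsOuterNormal S x n} := by
  refine ((isLocallyClosed_tfae _).out 0 3).mpr ?_
  rintro x ⟨n, hn1, r, hr, h⟩
  refine ⟨Metric.ball x r, Metric.mem_ball_self hr, Metric.isOpen_ball, fun y hy => ?_⟩
  refine ⟨n, IsOuterNormal.of_mem_hyperplane hn1 h hy.1 ?_⟩
  have hcl : IsClosed {z : Space d | inner ℝ (z - x) n = 0} :=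
    isClosed_eq (by fun_prop) continuous_const
  have h1 : y ∈ closure (Metric.ball x r ∩ {x | ∃ n, IsOuterNormal S x n}) :=
    Metric.isOpen_ball.inter_closure hy
  exact closure_minimal (fun z hz => hz.2.elim fun m hm =>
    IsOuterNormal.inner_eq_zero h hz.1 hm) hcl h1

lemma measurable_outerNormal {d : ℕ} (S : Set (Space d)) : Measurable (outerNormal S) := by
  classical
  set F : Set (Space d) := {x | ∃ n, IsOuterNormal S x n} with hF
  have hFm : MeasurableSet F := by
    obtain ⟨U, Z, hU, hZ, hUZ⟩ := isLocallyClosed_setOf_isOuterNormal S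
    rw [hF, hUZ]
    exact hU.measurableSet.inter hZ.measurableSet
  have hcont : ContinuousOn (outerNormal S) F := by
    rintro x ⟨n, hn1, r, hr, h⟩
    refine ContinuousWithinAt.congr_of_eventuallyEq (f := fun _ => n)
      continuousWithinAt_const ?_ (outerNormal_eq ⟨hn1, r, hr, h⟩)
    filter_upwards [self_mem_nhdsWithin, mem_nhdsWithin_of_mem_nhds (Metric.ball_mem_nhds x hr)]
      with y hy hyb
    obtain ⟨m, hm⟩ := hy
    exact outerNormal_eq (IsOuterNormal.of_mem_hyperplane hn1 h hyb
      (IsOuterNormal.inner_eq_zero h hyb hm))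
  have := hcont.measurable_piecewise (g := fun _ => 0) continuousOn_const hFm
  convert this using 1
  funext x
  by_cases hx : x ∈ F
  · rw [Set.piecewise_eq_of_mem _ _ _ hx]
  · rw [Set.piecewise_eq_of_notMem _ _ _ hx, outerNormal]
    exact dif_neg hx

/-! ### The Frobenius inner product -/

lemma gradInner_self {d : ℕ} (A : Space d →L[ℝ] Space d) :
    gradInner A A = ∑ j : Fin d, ‖A (EuclideanSpace.single j 1)‖ ^ 2 := by
  simp only [gradInner, real_inner_self_eq_norm_sq]

lemma gradInner_self_nonneg {d : ℕ} (A : Space d →L[ℝ] Space d) : 0 ≤ gradInner A A := by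
  rw [gradInner_self]
  positivity

lemma abs_inner_le_weighted {E : Type*} [NormedAddCommGroup E] [InnerProductSpace ℝ E] (x y : E)
    {t : ℝ} (ht : 0 < t) : |inner ℝ x y| ≤ (t * ‖x‖ ^ 2 + t⁻¹ * ‖y‖ ^ 2) / 2 := by
  refine (abs_real_inner_le_norm x y).trans ?_
  have h : 0 ≤ t⁻¹ * (t * ‖x‖ - ‖y‖) ^ 2 := by positivity
  have h2 : t⁻¹ * (t * ‖x‖ - ‖y‖) ^ 2 = t * ‖x‖ ^ 2 - 2 * (‖x‖ * ‖y‖) + t⁻¹ * ‖y‖ ^ 2 := by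
    field_simp
    ring
  linarith

lemma abs_gradInner_le {d : ℕ} (A B : Space d →L[ℝ] Space d) {t : ℝ} (ht : 0 < t) :
    |gradInner A B| ≤ (t * gradInner A A + t⁻¹ * gradInner B B) / 2 := by
  rw [gradInner_self, gradInner_self, gradInner, Finset.mul_sum, Finset.mul_sum,
    ← Finset.sum_add_distrib, Finset.sum_div]
  exact (Finset.abs_sum_le_sum_abs _ _).trans
    (Finset.sum_le_sum fun j _ => abs_inner_le_weighted _ _ ht)

lemma gradInner_sub_self_le {d : ℕ} (A B : Space d →L[ℝ] Space d) :
    gradInner (A - B) (A - B) ≤ 2 * gradInner A A + 2 * gradInner B B := by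
  rw [gradInner_self, gradInner_self, gradInner_self, Finset.mul_sum, Finset.mul_sum,
    ← Finset.sum_add_distrib]
  refine Finset.sum_le_sum fun j _ => ?_
  rw [sub_apply]
  have h := parallelogram_law_with_norm ℝ (A (EuclideanSpace.single j 1))
    (B (EuclideanSpace.single j 1))
  nlinarith [mul_self_nonneg ‖A (EuclideanSpace.single j 1) + B (EuclideanSpace.single j 1)‖]

lemma gradInner_self_le_sub {d : ℕ} (A B : Space d →L[ℝ] Space d) :
    gradInner A A ≤ 2 * gradInner (A - B) (A - B) + 2 * gradInner B B := by
  have h := gradInner_sub_self_le (A - B) (-B)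
  have hB : gradInner (-B) (-B) = gradInner B B := by simp [gradInner]
  rwa [sub_neg_eq_add, sub_add_cancel, hB] at h

/-- The operator norm is at most the Frobenius norm, by Cauchy-Schwarz in the coordinates of `n`. -/
lemma norm_apply_sq_le_gradInner {d : ℕ} (A : Space d →L[ℝ] Space d) {n : Space d}
    (hn : ‖n‖ ≤ 1) : ‖A n‖ ^ 2 ≤ gradInner A A := by
  have h1 : A n = ∑ j, n j • A (EuclideanSpace.single j 1) := by
    conv_lhs => rw [← (EuclideanSpace.basisFun (Fin d) ℝ).sum_repr n]
    simp [map_sum]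
  have h2 : ‖A n‖ ≤ ∑ j, |n j| * ‖A (EuclideanSpace.single j 1)‖ := by
    rw [h1]
    refine (norm_sum_le _ _).trans (le_of_eq ?_)
    simp [norm_smul]
  calc ‖A n‖ ^ 2 ≤ (∑ j, |n j| * ‖A (EuclideanSpace.single j 1)‖) ^ 2 :=
        pow_le_pow_left₀ (norm_nonneg _) h2 2
    _ ≤ (∑ j, |n j| ^ 2) * ∑ j, ‖A (EuclideanSpace.single j 1)‖ ^ 2 :=
        Finset.sum_mul_sq_le_sq_mul_sq _ _ _
    _ = ‖n‖ ^ 2 * gradInner A A := by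
        rw [gradInner_self, EuclideanSpace.norm_sq_eq]
        simp
    _ ≤ 1 * gradInner A A := by
        refine mul_le_mul_of_nonneg_right ?_ (gradInner_self_nonneg A)
        exact pow_le_one₀ (norm_nonneg _) hn
    _ = _ := one_mul _

lemma continuous_gradInner_self {d : ℕ} :
    Continuous fun A : Space d →L[ℝ] Space d => gradInner A A := by
  simp only [gradInner_self]
  fun_prop

lemma measurable_gradInner_fderiv {d : ℕ} (v : Space d → Space d) :
    Measurable fun x => gradInner (fderiv ℝ v x) (fderiv ℝ v x) :=
  continuous_gradInner_self.measurable.comp (measurable_fderiv ℝ v)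

/-! ### Polynomial vector fields -/

/-- The vector field with polynomial components `p`. -/
noncomputable def polyField {d : ℕ} (p : Fin d → MvPolynomial (Fin d) ℝ) (x : Space d) : Space d :=
  WithLp.toLp 2 fun i => MvPolynomial.eval (fun j => x j) (p i)

lemma totalDegree_pderiv_le {ι : Type*} (j : ι) (p : MvPolynomial ι ℝ) :
    (MvPolynomial.pderiv j p).totalDegree ≤ p.totalDegree := by
  classical
  conv_lhs => rw [p.as_sum, map_sum]
  refine (MvPolynomial.totalDegree_finsetSum _ _).trans (Finset.sup_le fun m hm => ?_)
  rw [MvPolynomial.pderiv_monomial]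
  refine (MvPolynomial.totalDegree_monomial_le _ _).trans ?_
  refine le_trans ?_ (MvPolynomial.le_totalDegree hm)
  change (m - Finsupp.single j 1).degree ≤ m.degree
  exact Finsupp.degree_mono tsub_le_self

lemma hasFDerivAt_eval {d : ℕ} (p : MvPolynomial (Fin d) ℝ) (x : Space d) :
    ∃ L : Space d →L[ℝ] ℝ, HasFDerivAt (fun y : Space d => MvPolynomial.eval (fun j => y j) p) L x ∧
      ∀ j, L (EuclideanSpace.single j 1) =
        MvPolynomial.eval (fun j => x j) (MvPolynomial.pderiv j p) := by
  induction p using MvPolynomial.induction_on with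
  | C a => exact ⟨0, by simpa using hasFDerivAt_const a x, by simp⟩
  | add p q hp hq =>
    obtain ⟨L, hL, hL'⟩ := hp
    obtain ⟨K, hK, hK'⟩ := hq
    exact ⟨L + K, by simp only [map_add]; exact hL.add hK, fun j => by simp [hL', hK']⟩
  | mul_X p i hp =>
    obtain ⟨L, hL, hL'⟩ := hp
    have hX : HasFDerivAt (fun y : Space d => y i)
        (EuclideanSpace.proj i : Space d →L[ℝ] ℝ) x :=
      (EuclideanSpace.proj i : Space d →L[ℝ] ℝ).hasFDerivAt
    refine ⟨_, by simp only [map_mul, MvPolynomial.eval_X]; exact hL.mul hX, fun j => ?_⟩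
    simp only [add_apply, smul_apply, smul_eq_mul, hL', PiLp.proj_apply, PiLp.single_apply,
      Derivation.leibniz, MvPolynomial.pderiv_X, Pi.single_apply,
      map_add, map_mul, MvPolynomial.eval_X]
    by_cases h : i = j <;> simp [h]

lemma hasFDerivAt_polyField {d : ℕ} (p : Fin d → MvPolynomial (Fin d) ℝ) (x : Space d) :
    ∃ L : Space d →L[ℝ] Space d, HasFDerivAt (polyField p) L x ∧
      ∀ j i, L (EuclideanSpace.single j 1) i =
        MvPolynomial.eval (fun j => x j) (MvPolynomial.pderiv j (p i)) := by
  choose L hL hL' using fun i => hasFDerivAt_eval (p i) x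
  refine ⟨((PiLp.continuousLinearEquiv 2 ℝ fun _ : Fin d => ℝ).symm :
    (Fin d → ℝ) →L[ℝ] Space d).comp (ContinuousLinearMap.pi L), ?_, fun j i => ?_⟩
  · exact ((PiLp.continuousLinearEquiv 2 ℝ fun _ : Fin d => ℝ).symm :
      (Fin d → ℝ) →L[ℝ] Space d).hasFDerivAt.comp x (hasFDerivAt_pi.mpr hL)
  · simpa using hL' i j

lemma gradInner_fderiv_polyField {d : ℕ} (p : Fin d → MvPolynomial (Fin d) ℝ) (x : Space d) :
    gradInner (fderiv ℝ (polyField p) x) (fderiv ℝ (polyField p) x) =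
      ∑ j, ∑ i, MvPolynomial.eval (fun j => x j) (MvPolynomial.pderiv j (p i)) ^ 2 := by
  obtain ⟨L, hL, hL'⟩ := hasFDerivAt_polyField p x
  rw [hL.fderiv, gradInner_self]
  refine Finset.sum_congr rfl fun j _ => ?_
  rw [EuclideanSpace.norm_sq_eq]
  simp [hL']

lemma continuous_fderiv_polyField {d : ℕ} (p : Fin d → MvPolynomial (Fin d) ℝ) :
    Continuous (fderiv ℝ (polyField p)) := by
  have h : ContDiff ℝ 1 (polyField p) := by
    rw [contDiff_euclidean]
    intro i
    have hp : ∀ q : MvPolynomial (Fin d) ℝ,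
        ContDiff ℝ 1 fun y : Space d => MvPolynomial.eval (fun j => y j) q := by
      intro q
      induction q using MvPolynomial.induction_on with
      | C a => simpa using contDiff_const
      | add p q hp hq => simpa using hp.add hq
      | mul_X p i hp =>
        have hX : ContDiff ℝ 1 fun y : Space d => y i :=
          (EuclideanSpace.proj i : Space d →L[ℝ] ℝ).contDiff
        simpa using hp.mul hX
    exact hp (p i)
  exact h.continuous_fderiv one_ne_zero

/-- `v` agrees on the simplex `T` with a polynomial field of degree at most `k`. -/
def IsPolyOn {d : ℕ} (k : ℕ) (T : Finset (Space d)) (v : Space d → Space d) : Prop :=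
  ∃ p : Fin d → MvPolynomial (Fin d) ℝ, (∀ i, (p i).totalDegree ≤ k) ∧
    ∀ x ∈ simplex T, v x = polyField p x

lemma isPolyOn_of_mem_feSpace {d k : ℕ} {cells : Finset (Finset (Space d))}
    {v : Space d → Space d} (hv : v ∈ feSpace cells k) {T : Finset (Space d)} (hT : T ∈ cells) :
    IsPolyOn k T v := by
  choose p hp hpe using hv.2 T hT
  refine ⟨p, hp, fun x hx => ?_⟩
  ext i
  exact hpe i x hx

lemma eventuallyEq_of_mem_interior {d : ℕ} {T : Finset (Space d)} {v w : Space d → Space d}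
    (h : ∀ x ∈ simplex T, v x = w x) {x : Space d} (hx : x ∈ interior (simplex T)) :
    v =ᶠ[nhds x] w :=
  Filter.eventually_of_mem (mem_interior_iff_mem_nhds.mp hx) h

lemma IsPolyOn.differentiableAt {d k : ℕ} {T : Finset (Space d)} {v : Space d → Space d}
    (h : IsPolyOn k T v) {x : Space d} (hx : x ∈ interior (simplex T)) :
    DifferentiableAt ℝ v x := by
  obtain ⟨p, -, hp⟩ := h
  obtain ⟨L, hL, -⟩ := hasFDerivAt_polyField p x
  exact hL.differentiableAt.congr_of_eventuallyEq (eventuallyEq_of_mem_interior hp hx)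

lemma ae_restrict_simplex_mem_interior {d : ℕ} (T : Finset (Space d)) :
    ∀ᵐ x ∂volume.restrict (simplex T), x ∈ interior (simplex T) := by
  rw [ae_restrict_iff' (measurableSet_simplex T)]
  filter_upwards [measure_eq_zero_iff_ae_notMem.mp (volume_frontier_simplex T)] with x hx hxT
  by_contra hni
  exact hx ⟨subset_closure hxT, hni⟩

lemma ae_gradInner_fderiv_eq {d : ℕ} {T : Finset (Space d)} {v w : Space d → Space d}
    (h : ∀ x ∈ simplex T, v x = w x) :
    (fun x => gradInner (fderiv ℝ v x) (fderiv ℝ v x)) =ᵐ[volume.restrict (simplex T)]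
      fun x => gradInner (fderiv ℝ w x) (fderiv ℝ w x) := by
  filter_upwards [ae_restrict_simplex_mem_interior T] with x hx
  rw [(eventuallyEq_of_mem_interior h hx).fderiv_eq]

lemma IsPolyOn.integrableOn_gradInner {d k : ℕ} {T : Finset (Space d)} {v : Space d → Space d}
    (h : IsPolyOn k T v) :
    IntegrableOn (fun x => gradInner (fderiv ℝ v x) (fderiv ℝ v x)) (simplex T) := by
  obtain ⟨p, -, hp⟩ := h
  have hc : Continuous fun x =>
      gradInner (fderiv ℝ (polyField p) x) (fderiv ℝ (polyField p) x) :=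
    continuous_gradInner_self.comp (continuous_fderiv_polyField p)
  exact (hc.continuousOn.integrableOn_compact (isCompact_simplex T)).congr
    (ae_gradInner_fderiv_eq hp).symm

/-! ### The trace inverse inequality -/

/-- A convex set with nonempty interior determines derivatives uniquely up to its boundary, so the
one-sided gradient on `Γ` is that of the polynomial. -/
lemma fderivWithin_eq_fderiv_polyField {d : ℕ} {T : Finset (Space d)} {v : Space d → Space d}
    {p : Fin d → MvPolynomial (Fin d) ℝ} (hi : (interior (simplex T)).Nonempty)
    (hp : ∀ x ∈ simplex T, v x = polyField p x) {x : Space d} (hx : x ∈ simplex T) :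
    fderivWithin ℝ v (simplex T) x = fderiv ℝ (polyField p) x := by
  obtain ⟨L, hL, -⟩ := hasFDerivAt_polyField p x
  rw [fderivWithin_congr hp (hp x hx)]
  exact hL.differentiableAt.fderivWithin
    (uniqueDiffOn_convex (convex_convexHull ℝ _) hi x hx)

/-- Each partial derivative of a component is again a polynomial of degree at most `k`, and the
element lies in the ball of radius `meshSize T` about the centre of its inscribed ball. -/
lemma exists_gradInner_le_integral (d k : ℕ) {σ : ℝ} (hσ : 0 < σ) :
    ∃ C : ℝ, 0 < C ∧ ∀ T : Finset (Space d), 0 < meshSize T →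
      (∃ x, Metric.closedBall x (meshSize T / (2 * σ)) ⊆ simplex T) →
      ∀ p : Fin d → MvPolynomial (Fin d) ℝ, (∀ i, (p i).totalDegree ≤ k) → ∀ y ∈ simplex T,
        meshSize T ^ d * gradInner (fderiv ℝ (polyField p) y) (fderiv ℝ (polyField p) y) ≤
          C * ∫ x in simplex T,
            gradInner (fderiv ℝ (polyField p) x) (fderiv ℝ (polyField p) x) := by
  obtain ⟨C, hC, hinv⟩ := exists_inverse_inequality d k (r := 1 / (2 * σ)) (by positivity)
  refine ⟨C, hC, fun T hT ⟨a, ha⟩ p hp y hy => ?_⟩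
  have hay : y ∈ Metric.closedBall a (meshSize T) :=
    dist_le_meshSize hy (ha (Metric.mem_closedBall_self (by positivity)))
  have hint : ∀ q : MvPolynomial (Fin d) ℝ, ∀ K : Set (Space d), IsCompact K →
      IntegrableOn (fun x : Space d => MvPolynomial.eval (fun j => x j) q ^ 2) K :=
    fun q K hK => ((continuous_eval_space q).pow 2).continuousOn.integrableOn_compact hK
  simp only [gradInner_fderiv_polyField]
  rw [integral_finsetSum _ fun j _ => integrable_finsetSum _ fun i _ =>
    hint _ _ (isCompact_simplex T), Finset.mul_sum, Finset.mul_sum]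
  refine Finset.sum_le_sum fun j _ => ?_
  rw [integral_finsetSum _ fun i _ => hint _ _ (isCompact_simplex T), Finset.mul_sum,
    Finset.mul_sum]
  refine Finset.sum_le_sum fun i _ => ?_
  refine (hinv _ ((totalDegree_pderiv_le j (p i)).trans (hp i)) a _ hT y hay).trans ?_
  refine mul_le_mul_of_nonneg_left ?_ hC.le
  rw [mul_one_div]
  exact setIntegral_mono_set (hint _ _ (isCompact_simplex T))
    (Filter.Eventually.of_forall fun x => sq_nonneg _) (Filter.Eventually.of_forall ha)

lemma exists_trace_inverse_inequality (d k : ℕ) (hd : 1 ≤ d) {σ : ℝ} (hσ : 0 < σ) :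
    ∃ C : ℝ, 0 < C ∧ ∀ T : Finset (Space d), T.card = d + 1 →
      AffineIndependent ℝ (fun p : T => (p : Space d)) →
      (∃ x, Metric.closedBall x (meshSize T / (2 * σ)) ⊆ simplex T) →
      ∀ v : Space d → Space d, IsPolyOn k T v →
      ∀ n : Space d → Space d, (∀ x, ‖n x‖ ≤ 1) →
      ∀ S ⊆ frontier (simplex T),
        meshSize T * ∫ x in S, ‖fderivWithin ℝ v (simplex T) x (n x)‖ ^ 2 ∂μHE[d - 1] ≤
          C * dirichletForm (simplex T) v v := by
  obtain ⟨C₁, hC₁, hinv⟩ := exists_gradInner_le_integral d k hσ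
  obtain ⟨C₂, hC₂, hsurf⟩ := exists_surfaceMeasure_frontier_le d hd
  refine ⟨C₁ * C₂, by positivity, fun T hc hT hball v ⟨p, hpd, hp⟩ n hn S hS => ?_⟩
  have hh : 0 < meshSize T := meshSize_pos (by omega)
  have hi := interior_simplex_nonempty hc hT
  set h := meshSize T
  set D : ℝ := dirichletForm (simplex T) v v with hD
  have hD0 : 0 ≤ D := integral_nonneg fun x => gradInner_self_nonneg _
  have hDp : D = ∫ x in simplex T,
      gradInner (fderiv ℝ (polyField p) x) (fderiv ℝ (polyField p) x) :=
    integral_congr_ae (ae_gradInner_fderiv_eq hp)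
  have hμ : μHE[d - 1] S ≤ ENNReal.ofReal (C₂ * h ^ (d - 1)) :=
    (measure_mono hS).trans (hsurf T hc hT)
  have hμr : (μHE[d - 1] : Measure (Space d)).real S ≤ C₂ * h ^ (d - 1) :=
    ENNReal.toReal_le_of_le_ofReal (by positivity) hμ
  -- A pointwise bound times the surface measure suffices: `h * h ^ (d - 1)` cancels `h ^ d`.
  have hpt : ∀ x ∈ S, ‖‖fderivWithin ℝ v (simplex T) x (n x)‖ ^ 2‖ ≤ C₁ * D / h ^ d := by
    intro x hx
    have hxT : x ∈ simplex T := (isCompact_simplex T).isClosed.frontier_subset (hS hx)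
    rw [Real.norm_of_nonneg (by positivity), fderivWithin_eq_fderiv_polyField hi hp hxT,
      le_div_iff₀ (by positivity), hDp, mul_comm]
    exact (mul_le_mul_of_nonneg_left (norm_apply_sq_le_gradInner _ (hn x)) (by positivity)).trans
      (hinv T hh hball p hpd x hxT)
  have h1 := (le_abs_self _).trans
    (norm_setIntegral_le_of_norm_le_const (hμ.trans_lt ENNReal.ofReal_lt_top) hpt)
  calc h * ∫ x in S, ‖fderivWithin ℝ v (simplex T) x (n x)‖ ^ 2 ∂μHE[d - 1]
      ≤ h * (C₁ * D / h ^ d * (C₂ * h ^ (d - 1))) :=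
        mul_le_mul_of_nonneg_left
          (h1.trans (mul_le_mul_of_nonneg_left hμr (by positivity))) hh.le
    _ = C₁ * C₂ * D * (h ^ (d - 1) * h) / h ^ d := by ring
    _ = C₁ * C₂ * D := by
        rw [← pow_succ, Nat.sub_add_cancel hd]
        field_simp

/-! ### Weighted Cauchy-Schwarz inequalities -/

lemma abs_integral_le_weighted {X : Type*} [MeasurableSpace X] {μ : Measure X} {f g h : X → ℝ}
    (hg : Integrable g μ) (hh : Integrable h μ) {t : ℝ}
    (hf : ∀ᵐ x ∂μ, |f x| ≤ (t * g x + t⁻¹ * h x) / 2) :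
    |∫ x, f x ∂μ| ≤ (t * ∫ x, g x ∂μ + t⁻¹ * ∫ x, h x ∂μ) / 2 := by
  rw [← integral_const_mul, ← integral_const_mul, ← integral_add (hg.const_mul t)
    (hh.const_mul t⁻¹), ← integral_div]
  have hint : Integrable (fun x => (t * g x + t⁻¹ * h x) / 2) μ :=
    ((hg.const_mul t).add (hh.const_mul t⁻¹)).div_const 2
  simp only [← Real.norm_eq_abs] at hf ⊢
  exact norm_integral_le_of_norm_le hint hf

lemma le_mul_sqrt_mul_sqrt {X K a b : ℝ} (hK : 0 ≤ K) (ha : 0 ≤ a) (hb : 0 ≤ b)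
    (h : ∀ t : ℝ, 0 < t → X ≤ K * ((t * a + t⁻¹ * b) / 2)) : X ≤ K * √a * √b := by
  set p := √a
  set q := √b
  have hp : 0 ≤ p := Real.sqrt_nonneg a
  have hq : 0 ≤ q := Real.sqrt_nonneg b
  have hpa : a = p ^ 2 := (Real.sq_sqrt ha).symm
  have hqb : b = q ^ 2 := (Real.sq_sqrt hb).symm
  have key : ∀ ε : ℝ, 0 < ε → X ≤ K * (p * q + ε * ((p + q) / 2)) := by
    intro ε hε
    -- The optimal weight is `q / p`; the shift by `ε` keeps it positive and finite when `a` or `b`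
    -- vanishes, and `ε` then tends to 0.
    refine (h ((q + ε) / (p + ε)) (by positivity)).trans (mul_le_mul_of_nonneg_left ?_ hK)
    have h1 : (q + ε) / (p + ε) * a ≤ (q + ε) * p := by
      rw [div_mul_eq_mul_div, div_le_iff₀ (by positivity), hpa]
      nlinarith [mul_nonneg (mul_nonneg (add_nonneg hq hε.le) hp) hε.le]
    have h2 : ((q + ε) / (p + ε))⁻¹ * b ≤ (p + ε) * q := by
      rw [inv_div, div_mul_eq_mul_div, div_le_iff₀ (by positivity), hqb]
      nlinarith [mul_nonneg (mul_nonneg (add_nonneg hp hε.le) hq) hε.le]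
    linarith
  have hlim : Filter.Tendsto (fun ε : ℝ => K * (p * q + ε * ((p + q) / 2)))
      (nhdsWithin 0 (Set.Ioi 0)) (nhds (K * p * q)) := by
    have hc : Continuous fun ε : ℝ => K * (p * q + ε * ((p + q) / 2)) := by fun_prop
    refine tendsto_nhdsWithin_of_tendsto_nhds ?_
    convert hc.tendsto 0 using 2
    ring
  exact ge_of_tendsto hlim (by filter_upwards [self_mem_nhdsWithin] with ε hε using key ε hε)

lemma abs_dirichletForm_le {d : ℕ} {S : Set (Space d)} {u v : Space d → Space d}
    (hu : IntegrableOn (fun x => gradInner (fderiv ℝ u x) (fderiv ℝ u x)) S)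
    (hv : IntegrableOn (fun x => gradInner (fderiv ℝ v x) (fderiv ℝ v x)) S) {t : ℝ}
    (ht : 0 < t) :
    |dirichletForm S u v| ≤ (t * dirichletForm S u u + t⁻¹ * dirichletForm S v v) / 2 :=
  abs_integral_le_weighted hu hv (Filter.Eventually.of_forall fun _ => abs_gradInner_le _ _ ht)

lemma dirichletForm_self_nonneg {d : ℕ} (S : Set (Space d)) (v : Space d → Space d) :
    0 ≤ dirichletForm S v v :=
  integral_nonneg fun _ => gradInner_self_nonneg _

/-! ### Geometry of the subdomains and of the cut mesh -/

namespace IsDecomposition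

variable {d : ℕ} {Ω₁ Ω₂ : Set (Space d)}

lemma ae_mem₁ (h : IsDecomposition Ω₁ Ω₂) : ∀ᵐ x : Space d, x ∈ closure Ω₁ → x ∈ Ω₁ := by
  filter_upwards [measure_eq_zero_iff_ae_notMem.mp h.null₁] with x hx hxc
  by_contra hn
  exact hx (h.isOpen₁.frontier_eq ▸ ⟨hxc, hn⟩)

lemma ae_mem₂ (h : IsDecomposition Ω₁ Ω₂) : ∀ᵐ x : Space d, x ∈ closure Ω₂ → x ∈ Ω₂ := by
  filter_upwards [measure_eq_zero_iff_ae_notMem.mp h.null₂] with x hx hxc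
  by_contra hn
  exact hx (h.isOpen₂.frontier_eq ▸ ⟨hxc, hn⟩)

end IsDecomposition

lemma closure_wholeDomain_subset {d : ℕ} (Ω₁ Ω₂ : Set (Space d)) :
    closure (wholeDomain Ω₁ Ω₂) ⊆ closure Ω₁ ∪ closure Ω₂ := by
  rw [← closure_union]
  exact closure_minimal interior_subset isClosed_closure

namespace OverlappingMeshes

variable {d : ℕ} {Ω₁ Ω₂ : Set (Space d)} (M : OverlappingMeshes Ω₁ Ω₂)

lemma T₁star_subset : M.T₁star ⊆ M.T₀.cells := by
  classical exact Finset.filter_subset _ _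

lemma region_T₁star_subset : region M.T₁star ⊆ closure Ω₁ ∪ closure Ω₂ := by
  refine Set.iUnion₂_subset fun T hT => ?_
  refine (simplex_subset_region (M.T₁star_subset hT)).trans ?_
  rw [M.region_T₀]
  exact closure_wholeDomain_subset Ω₁ Ω₂

/-- If `T` meets `Ω₂` in a null set, its interior misses the open set `Ω₂` and hence its closure, so
`T`, the closure of its interior, lies in `closure Ω₁`. Otherwise `T` is a cut element. -/
lemma mem_T₁star (hΩ : IsDecomposition Ω₁ Ω₂) {T : Finset (Space d)} (hT : T ∈ M.T₀.cells)
    {x : Space d} (hx : x ∈ Ω₁) (hxT : x ∈ interior (simplex T)) : T ∈ M.T₁star := by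
  classical
  refine Finset.mem_filter.mpr ⟨hT, ?_⟩
  by_cases h2 : volume (simplex T ∩ Ω₂) = 0
  · refine Or.inl ?_
    have hempty : interior (simplex T) ∩ Ω₂ = ∅ := by
      rw [← (isOpen_interior.inter hΩ.isOpen₂).measure_eq_zero_iff volume]
      exact measure_mono_null (Set.inter_subset_inter_left _ interior_subset) h2
    have hdisj : Disjoint (interior (simplex T)) (closure Ω₂) :=
      (Set.disjoint_iff_inter_eq_empty.mpr hempty).closure_right isOpen_interior
    have hsub : interior (simplex T) ⊆ closure Ω₁ := fun y hy => by
      have hy' : y ∈ closure (wholeDomain Ω₁ Ω₂) :=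
        M.region_T₀ ▸ simplex_subset_region hT (interior_subset hy)
      exact (closure_wholeDomain_subset Ω₁ Ω₂ hy').resolve_right
        (Set.disjoint_left.mp hdisj hy)
    have hconv := (convex_convexHull ℝ
      (T : Set (Space d))).closure_interior_eq_closure_of_nonempty_interior ⟨x, hxT⟩
    rw [(isCompact_simplex T).isClosed.closure_eq] at hconv
    rw [← hconv]
    exact closure_minimal hsub isClosed_closure
  · refine Or.inr ⟨?_, pos_iff_ne_zero.mpr h2⟩
    have hpos : 0 < volume (interior (simplex T) ∩ Ω₁) :=
      (isOpen_interior.inter hΩ.isOpen₁).measure_pos volume ⟨x, hxT, hx⟩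
    exact hpos.trans_le (measure_mono (Set.inter_subset_inter_left _ interior_subset))

lemma closure_subset_region_T₁star (hΩ : IsDecomposition Ω₁ Ω₂) :
    closure Ω₁ ⊆ region M.T₁star := by
  refine closure_minimal ?_ (isCompact_region _).isClosed
  have h0 : volume (Ω₁ \ region M.T₁star) = 0 := by
    rw [measure_eq_zero_iff_ae_notMem]
    filter_upwards [ae_mem_interior_of_mem_region M.T₀.cells] with x hx hmem
    have hxr : x ∈ region M.T₀.cells := by
      rw [M.region_T₀]
      exact subset_closure (interior_maximal (Set.subset_union_left.trans subset_closure)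
        hΩ.isOpen₁ hmem.1)
    obtain ⟨T, hT, hxT⟩ := hx hxr
    exact hmem.2 (simplex_subset_region (M.mem_T₁star hΩ hT hmem.1 hxT) (interior_subset hxT))
  -- An open null set is empty, which upgrades covering almost everywhere to covering.
  rw [(hΩ.isOpen₁.sdiff (isCompact_region _).isClosed).measure_eq_zero_iff volume] at h0
  exact Set.sdiff_eq_empty.mp h0

/-- An interior point of `T` is interior to `closure Ω₂`, hence not on `Γ`. So only boundary faces
carry interface integrals. -/
lemma interface_inter_simplex_subset_frontier {T : Finset (Space d)} (hT : T ∈ M.T₂.cells) :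
    interface Ω₁ Ω₂ ∩ simplex T ⊆ frontier (simplex T) := by
  rintro x ⟨⟨-, hx2⟩, hxT⟩
  refine ⟨subset_closure hxT, fun hi => hx2.2 ?_⟩
  refine interior_mono ?_ hi
  rw [← M.region_T₂]
  exact simplex_subset_region hT

lemma isCompact_interface_inter (T : Finset (Space d)) :
    IsCompact (interface Ω₁ Ω₂ ∩ simplex T) :=
  (isCompact_simplex T).inter_left (isClosed_frontier.inter isClosed_frontier)

lemma surfaceMeasure_interface_inter_lt_top (hd : 1 ≤ d) {T : Finset (Space d)}
    (hT : T ∈ M.T₂.cells) : μHE[d - 1] (interface Ω₁ Ω₂ ∩ simplex T) < ⊤ := by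
  obtain ⟨C, -, hC⟩ := exists_surfaceMeasure_frontier_le d hd
  exact (measure_mono (M.interface_inter_simplex_subset_frontier hT)).trans_lt
    ((hC T (M.T₂.card_eq T hT) (M.T₂.affineIndependent T hT)).trans_lt ENNReal.ofReal_lt_top)

/-! ### The bulk terms -/

section Bulk

variable {M} {k : ℕ} {v : (Space d → Space d) × (Space d → Space d)}

lemma integrableOn_region_fst (hv : v ∈ M.velocitySpace k) :
    IntegrableOn (fun x => gradInner (fderiv ℝ v.1 x) (fderiv ℝ v.1 x)) (region M.T₁star) :=
  integrableOn_region fun _ hT => (isPolyOn_of_mem_feSpace hv.1 hT).integrableOn_gradInner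

lemma integrableOn_closure_snd (hv : v ∈ M.velocitySpace k) :
    IntegrableOn (fun x => gradInner (fderiv ℝ v.2 x) (fderiv ℝ v.2 x)) (closure Ω₂) := by
  rw [← M.region_T₂]
  exact integrableOn_region fun _ hT => (isPolyOn_of_mem_feSpace hv.2 hT).integrableOn_gradInner

lemma sum_dirichletForm_fst (hv : v ∈ M.velocitySpace k) :
    ∑ T ∈ M.T₁star, dirichletForm (simplex T) v.1 v.1 =
      dirichletForm (region M.T₁star) v.1 v.1 :=
  (M.T₀.integral_region M.T₁star_subset fun _ hT =>
    (isPolyOn_of_mem_feSpace hv.1 hT).integrableOn_gradInner).symm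

lemma sum_dirichletForm_snd (hΩ : IsDecomposition Ω₁ Ω₂) (hv : v ∈ M.velocitySpace k) :
    ∑ T ∈ M.T₂.cells, dirichletForm (simplex T) v.2 v.2 = dirichletForm Ω₂ v.2 v.2 := by
  have h := M.T₂.integral_region (Finset.Subset.refl _) fun T hT =>
    (isPolyOn_of_mem_feSpace hv.2 hT).integrableOn_gradInner
  rw [M.region_T₂] at h
  refine h.symm.trans (setIntegral_congr_set ?_)
  filter_upwards [hΩ.ae_mem₂] with x hx
  exact propext ⟨hx, fun h => subset_closure h⟩

lemma measurableSet_overlap (hΩ : IsDecomposition Ω₁ Ω₂) : MeasurableSet M.overlap :=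
  hΩ.isOpen₂.measurableSet.inter (isCompact_region _).measurableSet

/-- The two meshes do not match, but almost every point of the overlap is interior to an element of
each, where both fields are smooth. -/
lemma ae_fderiv_sub (hΩ : IsDecomposition Ω₁ Ω₂) (hv : v ∈ M.velocitySpace k) :
    ∀ᵐ x ∂volume.restrict M.overlap, fderiv ℝ (v.1 - v.2) x = fderiv ℝ v.1 x - fderiv ℝ v.2 x := by
  rw [ae_restrict_iff' (measurableSet_overlap hΩ)]
  filter_upwards [ae_mem_interior_of_mem_region M.T₁star,
    ae_mem_interior_of_mem_region M.T₂.cells] with x h1 h2 hx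
  obtain ⟨S, hS, hxS⟩ := h1 hx.2
  obtain ⟨T, hT, hxT⟩ := h2 (M.region_T₂ ▸ subset_closure hx.1)
  exact fderiv_sub ((isPolyOn_of_mem_feSpace hv.1 hS).differentiableAt hxS)
    ((isPolyOn_of_mem_feSpace hv.2 hT).differentiableAt hxT)

lemma integrableOn_overlap_fst (hv : v ∈ M.velocitySpace k) :
    IntegrableOn (fun x => gradInner (fderiv ℝ v.1 x) (fderiv ℝ v.1 x)) M.overlap :=
  (integrableOn_region_fst hv).mono_set Set.inter_subset_right

lemma integrableOn_overlap_snd (hv : v ∈ M.velocitySpace k) :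
    IntegrableOn (fun x => gradInner (fderiv ℝ v.2 x) (fderiv ℝ v.2 x)) M.overlap :=
  (integrableOn_closure_snd hv).mono_set (Set.inter_subset_left.trans subset_closure)

lemma integrableOn_overlap_sub (hΩ : IsDecomposition Ω₁ Ω₂) (hv : v ∈ M.velocitySpace k) :
    IntegrableOn (fun x => gradInner (fderiv ℝ (v.1 - v.2) x) (fderiv ℝ (v.1 - v.2) x))
      M.overlap := by
  refine (((integrableOn_overlap_fst hv).const_mul 2).add
    ((integrableOn_overlap_snd hv).const_mul 2)).mono'
    (measurable_gradInner_fderiv _).aestronglyMeasurable ?_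
  filter_upwards [ae_fderiv_sub hΩ hv] with x hx
  rw [Real.norm_of_nonneg (gradInner_self_nonneg _), hx]
  exact gradInner_sub_self_le _ _

lemma dirichletForm_overlap_snd_le (hv : v ∈ M.velocitySpace k) :
    dirichletForm M.overlap v.2 v.2 ≤ dirichletForm Ω₂ v.2 v.2 :=
  setIntegral_mono_set ((integrableOn_closure_snd hv).mono_set subset_closure)
    (Filter.Eventually.of_forall fun _ => gradInner_self_nonneg _)
    (Filter.Eventually.of_forall Set.inter_subset_left)

lemma dirichletForm_overlap_fst_le (hv : v ∈ M.velocitySpace k) :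
    dirichletForm M.overlap v.1 v.1 ≤ dirichletForm (region M.T₁star) v.1 v.1 :=
  setIntegral_mono_set (integrableOn_region_fst hv)
    (Filter.Eventually.of_forall fun _ => gradInner_self_nonneg _)
    (Filter.Eventually.of_forall Set.inter_subset_right)

lemma dirichletForm_left_le (hΩ : IsDecomposition Ω₁ Ω₂) (hv : v ∈ M.velocitySpace k) :
    dirichletForm Ω₁ v.1 v.1 ≤ dirichletForm (region M.T₁star) v.1 v.1 :=
  setIntegral_mono_set (integrableOn_region_fst hv)
    (Filter.Eventually.of_forall fun _ => gradInner_self_nonneg _)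
    (Filter.Eventually.of_forall (subset_closure.trans (M.closure_subset_region_T₁star hΩ)))

lemma s_self_le (hΩ : IsDecomposition Ω₁ Ω₂) (hv : v ∈ M.velocitySpace k) :
    M.s v v ≤ 2 * dirichletForm (region M.T₁star) v.1 v.1 + 2 * dirichletForm Ω₂ v.2 v.2 := by
  have h : M.s v v ≤ 2 * dirichletForm M.overlap v.1 v.1 +
      2 * dirichletForm M.overlap v.2 v.2 := by
    have h1 := (integrableOn_overlap_fst hv).const_mul 2
    have h2 := (integrableOn_overlap_snd hv).const_mul 2
    simp only [dirichletForm, ← integral_const_mul]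
    rw [← integral_add h1 h2]
    refine integral_mono_ae (integrableOn_overlap_sub hΩ hv) (h1.add h2) ?_
    filter_upwards [ae_fderiv_sub hΩ hv] with x hx
    rw [hx]
    exact gradInner_sub_self_le _ _
  linarith [dirichletForm_overlap_fst_le hv, dirichletForm_overlap_snd_le hv]

/-- The overlap penalty controls the gradient of `v₁` beyond `Ω₁`. -/
lemma dirichletForm_region_T₁star_le (hΩ : IsDecomposition Ω₁ Ω₂)
    (hv : v ∈ M.velocitySpace k) :
    dirichletForm (region M.T₁star) v.1 v.1 ≤
      dirichletForm Ω₁ v.1 v.1 + 2 * M.s v v + 2 * dirichletForm Ω₂ v.2 v.2 := by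
  have hint1 : IntegrableOn (fun x => gradInner (fderiv ℝ v.1 x) (fderiv ℝ v.1 x)) Ω₁ :=
    (integrableOn_region_fst hv).mono_set
      (subset_closure.trans (M.closure_subset_region_T₁star hΩ))
  have hdisj : Disjoint Ω₁ M.overlap := hΩ.disjoint.mono_right Set.inter_subset_left
  have hsplit : dirichletForm (region M.T₁star) v.1 v.1 =
      dirichletForm Ω₁ v.1 v.1 + dirichletForm M.overlap v.1 v.1 := by
    rw [dirichletForm, dirichletForm, dirichletForm, ← setIntegral_union
      hdisj (measurableSet_overlap hΩ) hint1
      (integrableOn_overlap_fst hv)]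
    -- `Ω₁*` lies in the union of the two closures, whose boundaries are null, and it covers `Ω₁`.
    refine setIntegral_congr_set ?_
    filter_upwards [hΩ.ae_mem₁, hΩ.ae_mem₂] with x h1 h2
    refine propext ⟨fun hx => ?_, fun hx => ?_⟩
    · rcases M.region_T₁star_subset hx with hx1 | hx2
      · exact Or.inl (h1 hx1)
      · exact Or.inr ⟨h2 hx2, hx⟩
    · exact hx.elim (fun hx1 => M.closure_subset_region_T₁star hΩ (subset_closure hx1))
        fun hx2 => hx2.2
  have hover : dirichletForm M.overlap v.1 v.1 ≤
      2 * M.s v v + 2 * dirichletForm M.overlap v.2 v.2 := by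
    have h1 := (integrableOn_overlap_sub hΩ hv).const_mul 2
    have h2 := (integrableOn_overlap_snd hv).const_mul 2
    simp only [s, dirichletForm, ← integral_const_mul]
    rw [← integral_add h1 h2]
    refine integral_mono_ae (integrableOn_overlap_fst hv) (h1.add h2) ?_
    filter_upwards [ae_fderiv_sub hΩ hv] with x hx
    rw [hx]
    exact gradInner_self_le_sub _ _
  linarith [dirichletForm_overlap_snd_le hv]

end Bulk

/-! ### The interface terms -/

lemma interfaceNormSq_nonneg (α : ℝ) (f : Finset (Space d) → Space d → Space d) :
    0 ≤ M.interfaceNormSq α f :=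
  Finset.sum_nonneg fun T _ => mul_nonneg (Real.rpow_nonneg (meshSize_nonneg T) _)
    (integral_nonneg fun _ => sq_nonneg _)

lemma interfaceNormSq_neg_half (f : Finset (Space d) → Space d → Space d) :
    M.interfaceNormSq (-1 / 2) f = ∑ T ∈ M.T₂.cells, meshSize T *
      ∫ x in interface Ω₁ Ω₂ ∩ simplex T, ‖f T x‖ ^ 2 ∂μHE[d - 1] := by
  refine Finset.sum_congr rfl fun T _ => ?_
  norm_num

lemma interfaceNormSq_half (f : Finset (Space d) → Space d → Space d) :
    M.interfaceNormSq (1 / 2) f = ∑ T ∈ M.T₂.cells, (meshSize T)⁻¹ *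
      ∫ x in interface Ω₁ Ω₂ ∩ simplex T, ‖f T x‖ ^ 2 ∂μHE[d - 1] := by
  refine Finset.sum_congr rfl fun T _ => ?_
  rw [← Real.rpow_neg_one]
  norm_num

lemma meshSize_pos_of_mem (hd : 1 ≤ d) {T : Finset (Space d)} (hT : T ∈ M.T₂.cells) :
    0 < meshSize T :=
  meshSize_pos (by rw [M.T₂.card_eq T hT]; omega)

/-- Square integrability on the interface, element by element. -/
def InterfaceSqIntegrable (f : Finset (Space d) → Space d → Space d) : Prop :=
  ∀ T ∈ M.T₂.cells,
    IntegrableOn (fun x => ‖f T x‖ ^ 2) (interface Ω₁ Ω₂ ∩ simplex T) μHE[d - 1]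

variable {M} in
lemma abs_interfaceInner_le (hd : 1 ≤ d) {f g : Finset (Space d) → Space d → Space d}
    (hf : M.InterfaceSqIntegrable f) (hg : M.InterfaceSqIntegrable g) {t : ℝ} (ht : 0 < t) :
    |M.interfaceInner f g| ≤
      (t * M.interfaceNormSq (-1 / 2) f + t⁻¹ * M.interfaceNormSq (1 / 2) g) / 2 := by
  rw [interfaceNormSq_neg_half, interfaceNormSq_half, Finset.mul_sum, Finset.mul_sum,
    ← Finset.sum_add_distrib, Finset.sum_div]
  refine (Finset.abs_sum_le_sum_abs _ _).trans (Finset.sum_le_sum fun T hT => ?_)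
  have hh := M.meshSize_pos_of_mem hd hT
  have h := abs_integral_le_weighted (hf T hT) (hg T hT) (t := t * meshSize T)
    (f := fun x => inner ℝ (f T x) (g T x)) (Filter.Eventually.of_forall fun x =>
      abs_inner_le_weighted _ _ (mul_pos ht hh))
  rwa [mul_inv, mul_assoc, mul_assoc] at h

/-- Lets the penalty term be estimated by the same duality `abs_interfaceInner_le` as the flux
terms. -/
lemma interfaceNormSq_smul (hd : 1 ≤ d) (f : Finset (Space d) → Space d → Space d) :
    M.interfaceNormSq (-1 / 2) (fun T x => (meshSize T)⁻¹ • f T x) =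
      M.interfaceNormSq (1 / 2) f := by
  rw [interfaceNormSq_neg_half, interfaceNormSq_half]
  refine Finset.sum_congr rfl fun T hT => ?_
  have hh := M.meshSize_pos_of_mem hd hT
  simp only [norm_smul, mul_pow, integral_const_mul, norm_inv, Real.norm_of_nonneg hh.le]
  field_simp

lemma interfaceInner_smul_self (f : Finset (Space d) → Space d → Space d) :
    M.interfaceInner (fun T x => (meshSize T)⁻¹ • f T x) f = M.interfaceNormSq (1 / 2) f := by
  rw [interfaceNormSq_half]
  refine Finset.sum_congr rfl fun T hT => ?_
  simp only [real_inner_smul_left, real_inner_self_eq_norm_sq, integral_const_mul]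

section Interface

variable {M} {k : ℕ} {v : (Space d → Space d) × (Space d → Space d)}

lemma interfaceSqIntegrable_smul {f : Finset (Space d) → Space d → Space d}
    (hf : M.InterfaceSqIntegrable f) :
    M.InterfaceSqIntegrable fun T x => (meshSize T)⁻¹ • f T x := by
  intro T hT
  simp only [norm_smul, mul_pow]
  exact (hf T hT).const_mul _

lemma interfaceSqIntegrable_jump (hd : 1 ≤ d) (hΩ : IsDecomposition Ω₁ Ω₂)
    (hv : v ∈ M.velocitySpace k) : M.InterfaceSqIntegrable (jump v) := by
  intro T hT
  have h1 : ContinuousOn v.1 (interface Ω₁ Ω₂ ∩ simplex T) :=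
    hv.1.1.mono fun x hx => M.closure_subset_region_T₁star hΩ
      (isClosed_closure.frontier_subset hx.1.1)
  have h2 : ContinuousOn v.2 (interface Ω₁ Ω₂ ∩ simplex T) :=
    hv.2.1.mono fun x hx => simplex_subset_region hT hx.2
  exact ((h2.sub h1).norm.pow 2).integrableOn_of_subset_isCompact
    (isCompact_interface_inter T) (isCompact_interface_inter T).measurableSet subset_rfl
    (M.surfaceMeasure_interface_inter_lt_top hd hT).ne

/-- The flux is bounded on a set of finite surface measure; its measurability rests on that of
`outerNormal`. -/
lemma interfaceSqIntegrable_meanFlux (hd : 1 ≤ d) (hv : v ∈ M.velocitySpace k) :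
    M.InterfaceSqIntegrable (M.meanFlux v) := by
  intro T hT
  obtain ⟨p, -, hp⟩ := isPolyOn_of_mem_feSpace hv.2 hT
  have hi := interior_simplex_nonempty (M.T₂.card_eq T hT) (M.T₂.affineIndependent T hT)
  have hms := (isCompact_interface_inter (Ω₁ := Ω₁) (Ω₂ := Ω₂) T).measurableSet
  have hm : Measurable fun x => ‖fderiv ℝ (polyField p) x (outerNormal (closure Ω₂) x)‖ ^ 2 := by
    have happ : Continuous fun q : (Space d →L[ℝ] Space d) × Space d => q.1 q.2 :=
      isBoundedBilinearMap_apply.continuous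
    exact ((happ.measurable.comp ((continuous_fderiv_polyField p).measurable.prodMk
      (measurable_outerNormal (closure Ω₂)))).norm).pow_const 2
  have hcong : Set.EqOn (fun x => ‖fderiv ℝ (polyField p) x (outerNormal (closure Ω₂) x)‖ ^ 2)
      (fun x => ‖M.meanFlux v T x‖ ^ 2) (interface Ω₁ Ω₂ ∩ simplex T) := by
    intro x hx
    simp only [meanFlux, fderivWithin_eq_fderiv_polyField hi hp hx.2]
  obtain ⟨K, hK⟩ := (isCompact_simplex T).exists_bound_of_continuousOn
    (continuous_gradInner_self.comp (continuous_fderiv_polyField p)).continuousOn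
  refine IntegrableOn.congr_fun ?_ hcong hms
  refine Measure.integrableOn_of_bounded (M := K)
    (M.surfaceMeasure_interface_inter_lt_top hd hT).ne hm.aestronglyMeasurable ?_
  rw [ae_restrict_iff' hms]
  refine Filter.Eventually.of_forall fun x hx => ?_
  rw [Real.norm_of_nonneg (sq_nonneg _)]
  exact (norm_apply_sq_le_gradInner _ (norm_outerNormal_le _ x)).trans
    ((le_abs_self _).trans (hK x hx.2))

end Interface

lemma exists_interfaceNormSq_meanFlux_le (d k : ℕ) (hd : 1 ≤ d) {σ : ℝ} (hσ : 0 < σ) :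
    ∃ C : ℝ, 0 < C ∧ ∀ (Ω₁ Ω₂ : Set (Space d)) (M : OverlappingMeshes Ω₁ Ω₂),
      M.T₂.ShapeRegular σ → ∀ v ∈ M.velocitySpace k,
        M.interfaceNormSq (-1 / 2) (M.meanFlux v) ≤
          C * ∑ T ∈ M.T₂.cells, dirichletForm (simplex T) v.2 v.2 := by
  obtain ⟨C, hC, h⟩ := exists_trace_inverse_inequality d k hd hσ
  refine ⟨C, hC, fun Ω₁ Ω₂ M hM v hv => ?_⟩
  rw [interfaceNormSq_neg_half, Finset.mul_sum]
  exact Finset.sum_le_sum fun T hT => h T (M.T₂.card_eq T hT) (M.T₂.affineIndependent T hT)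
    (hM T hT) v.2 (isPolyOn_of_mem_feSpace hv.2 hT) _ (norm_outerNormal_le _) _
    (M.interface_inter_simplex_subset_frontier hT)

/-! ### Boundedness and coercivity -/

lemma sq_starNorm {k : ℕ} (hΩ : IsDecomposition Ω₁ Ω₂)
    {v : (Space d → Space d) × (Space d → Space d)} (hv : v ∈ M.velocitySpace k) :
    M.starNorm v ^ 2 = dirichletForm (region M.T₁star) v.1 v.1 + dirichletForm Ω₂ v.2 v.2
      + M.interfaceNormSq (-1 / 2) (M.meanFlux v) + M.interfaceNormSq (1 / 2) (jump v) := by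
  rw [starNorm, sum_dirichletForm_fst hv, sum_dirichletForm_snd hΩ hv, Real.sq_sqrt]
  have h1 := dirichletForm_self_nonneg (region M.T₁star) v.1
  have h2 := dirichletForm_self_nonneg Ω₂ v.2
  have h3 := M.interfaceNormSq_nonneg (-1 / 2) (M.meanFlux v)
  have h4 := M.interfaceNormSq_nonneg (1 / 2) (jump v)
  positivity

theorem a_add_s_le {k : ℕ} (hd : 1 ≤ d) (hΩ : IsDecomposition Ω₁ Ω₂) {γ : ℝ} (hγ : 0 ≤ γ)
    {u v : (Space d → Space d) × (Space d → Space d)} (hu : u ∈ M.velocitySpace k)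
    (hv : v ∈ M.velocitySpace k) :
    M.a γ u v + M.s u v ≤ (3 + γ) * M.starNorm u * M.starNorm v := by
  have hsqrt : ∀ w, M.starNorm w = √(M.starNorm w ^ 2) := fun w =>
    (Real.sqrt_sq (Real.sqrt_nonneg _)).symm
  rw [hsqrt u, hsqrt v]
  refine le_mul_sqrt_mul_sqrt (by linarith) (sq_nonneg _) (sq_nonneg _) fun t ht => ?_
  rw [M.sq_starNorm hΩ hu, M.sq_starNorm hΩ hv]
  have hΩ₁ : Ω₁ ⊆ region M.T₁star := subset_closure.trans (M.closure_subset_region_T₁star hΩ)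
  have h1 := (abs_le.mp (abs_dirichletForm_le ((integrableOn_region_fst hu).mono_set hΩ₁)
    ((integrableOn_region_fst hv).mono_set hΩ₁) ht)).2
  have h2 := (abs_le.mp (abs_dirichletForm_le ((integrableOn_closure_snd hu).mono_set
    subset_closure) ((integrableOn_closure_snd hv).mono_set subset_closure) ht)).2
  have h3 := (abs_le.mp (abs_interfaceInner_le hd (interfaceSqIntegrable_meanFlux hd hu)
    (interfaceSqIntegrable_jump hd hΩ hv) ht)).1
  -- Here the flux belongs to `v` and the jump to `u`, so the weight is inverted to keep `t` on the
  -- terms in `u`.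
  have h4 := (abs_le.mp (abs_interfaceInner_le hd (interfaceSqIntegrable_meanFlux hd hv)
    (interfaceSqIntegrable_jump hd hΩ hu) (inv_pos.mpr ht))).1
  have h5 := (abs_le.mp (abs_interfaceInner_le hd
    (interfaceSqIntegrable_smul (interfaceSqIntegrable_jump hd hΩ hu))
    (interfaceSqIntegrable_jump hd hΩ hv) ht)).2
  have h6 := (abs_le.mp (abs_dirichletForm_le (integrableOn_overlap_sub hΩ hu)
    (integrableOn_overlap_sub hΩ hv) ht)).2
  rw [inv_inv] at h4
  rw [M.interfaceNormSq_smul hd] at h5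
  have ht' : 0 < t⁻¹ := inv_pos.mpr ht
  have h7 := mul_le_mul_of_nonneg_left h5 hγ
  have h8 := mul_le_mul_of_nonneg_left (dirichletForm_left_le hΩ hu) ht.le
  have h9 := mul_le_mul_of_nonneg_left (dirichletForm_left_le hΩ hv) ht'.le
  have h10 := mul_le_mul_of_nonneg_left (s_self_le hΩ hu) ht.le
  have h11 := mul_le_mul_of_nonneg_left (s_self_le hΩ hv) ht'.le
  rw [a]
  change M.s u v ≤ (t * M.s u u + t⁻¹ * M.s v v) / 2 at h6
  have p1 := dirichletForm_self_nonneg (region M.T₁star) u.1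
  have p2 := dirichletForm_self_nonneg (region M.T₁star) v.1
  have p3 := dirichletForm_self_nonneg Ω₂ u.2
  have p4 := dirichletForm_self_nonneg Ω₂ v.2
  have p5 := M.interfaceNormSq_nonneg (-1 / 2) (M.meanFlux u)
  have p6 := M.interfaceNormSq_nonneg (-1 / 2) (M.meanFlux v)
  have p7 := M.interfaceNormSq_nonneg (1 / 2) (jump u)
  have p8 := M.interfaceNormSq_nonneg (1 / 2) (jump v)
  generalize M.s u u = su at *
  generalize M.s v v = sv at *
  generalize dirichletForm (region M.T₁star) u.1 u.1 = gu at *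
  generalize dirichletForm (region M.T₁star) v.1 v.1 = gv at *
  generalize dirichletForm Ω₂ u.2 u.2 = bu at *
  generalize dirichletForm Ω₂ v.2 v.2 = bv at *
  generalize M.interfaceNormSq (-1 / 2) (M.meanFlux u) = fu at *
  generalize M.interfaceNormSq (-1 / 2) (M.meanFlux v) = fv at *
  generalize M.interfaceNormSq (1 / 2) (jump u) = ju at *
  generalize M.interfaceNormSq (1 / 2) (jump v) = jv at *
  generalize t⁻¹ = r at *
  have q1 := mul_nonneg ht.le p5
  have q2 := mul_nonneg ht'.le p6
  have q3 := mul_nonneg ht.le p7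
  have q4 := mul_nonneg ht'.le p8
  have q5 := mul_nonneg hγ (mul_nonneg ht.le (add_nonneg (add_nonneg p1 p3) p5))
  have q6 := mul_nonneg hγ (mul_nonneg ht'.le (add_nonneg (add_nonneg p2 p4) p6))
  linarith

theorem le_a_add_s {k : ℕ} (hd : 1 ≤ d) (hΩ : IsDecomposition Ω₁ Ω₂) {C γ : ℝ} (hC : 0 < C)
    (hγ : 2 * C + 1 ≤ γ) {v : (Space d → Space d) × (Space d → Space d)}
    (hv : v ∈ M.velocitySpace k)
    (htrace : M.interfaceNormSq (-1 / 2) (M.meanFlux v) ≤ C * dirichletForm Ω₂ v.2 v.2) :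
    (6 + 2 * C)⁻¹ * M.starNorm v ^ 2 ≤ M.a γ v v + M.s v v := by
  -- In the letters introduced below, the squared norm is at most `a₁ + 2 * sv + (3 + C) * b + j`,
  -- while the form is at least `a₁ + b / 2 + sv + j`; the terms in `b` dictate the factor `6 + 2 *
  -- C`.
  rw [inv_mul_le_iff₀ (by positivity), M.sq_starNorm hΩ hv, a, interfaceInner_smul_self]
  -- With this weight, twice the pairing costs at most half the energy of `v.2` and `2 * C` of the
  -- penalty, so at least one unit of the latter survives.
  have h1 := (abs_le.mp (abs_interfaceInner_le hd (interfaceSqIntegrable_meanFlux hd hv)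
    (interfaceSqIntegrable_jump hd hΩ hv) (t := (2 * C)⁻¹) (by positivity))).2
  have h2 := dirichletForm_region_T₁star_le hΩ hv
  have h3 : (2 * C)⁻¹ * M.interfaceNormSq (-1 / 2) (M.meanFlux v) ≤
      dirichletForm Ω₂ v.2 v.2 / 2 := by
    rw [inv_mul_le_iff₀ (by positivity)]
    linarith
  rw [inv_inv] at h1
  have p1 := dirichletForm_self_nonneg Ω₁ v.1
  have p2 := dirichletForm_self_nonneg Ω₂ v.2
  have p3 : 0 ≤ M.s v v := dirichletForm_self_nonneg _ _
  have p4 := M.interfaceNormSq_nonneg (1 / 2) (jump v)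
  have h4 := mul_le_mul_of_nonneg_right hγ p4
  generalize M.s v v = sv at *
  generalize dirichletForm (region M.T₁star) v.1 v.1 = g at *
  generalize dirichletForm Ω₁ v.1 v.1 = a₁ at *
  generalize dirichletForm Ω₂ v.2 v.2 = b at *
  generalize M.interfaceNormSq (-1 / 2) (M.meanFlux v) = f at *
  generalize M.interfaceNormSq (1 / 2) (jump v) = j at *
  generalize M.interfaceInner (M.meanFlux v) (jump v) = i at *
  have h5 : a₁ + b / 2 + sv + j ≤ a₁ + b - i - i + γ * j + sv := by linarith
  have h6 := mul_le_mul_of_nonneg_left h5 (show (0 : ℝ) ≤ 6 + 2 * C by positivity)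
  have q1 := mul_nonneg hC.le p1
  have q3 := mul_nonneg hC.le p3
  have q4 := mul_nonneg hC.le p4
  linarith

end OverlappingMeshes

end OverlapNitsche

theorem mainTheorem5 (d : ℕ) (hd : d = 2 ∨ d = 3) (k : ℕ) (σ : ℝ) (hσ : 0 < σ) :
    ∃ γ₀ : ℝ, 0 < γ₀ ∧ ∀ γ : ℝ, γ₀ ≤ γ →
      ∀ Ω₁ Ω₂ : Set (OverlapNitsche.Space d), OverlapNitsche.IsDecomposition Ω₁ Ω₂ →
        ∃ c C : ℝ, 0 < c ∧ 0 < C ∧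
          ∀ M : OverlapNitsche.OverlappingMeshes Ω₁ Ω₂,
            M.T₀.ShapeRegular σ → M.T₂.ShapeRegular σ →
              (∀ u ∈ M.velocitySpace k, ∀ v ∈ M.velocitySpace k,
                M.a γ u v + M.s u v ≤ C * M.starNorm u * M.starNorm v) ∧
              (∀ v ∈ M.velocitySpace k,
                c * M.starNorm v ^ 2 ≤ M.a γ v v + M.s v v) := by
  have hd1 : 1 ≤ d := by omega
  obtain ⟨C, hC, htrace⟩ :=
    OverlapNitsche.OverlappingMeshes.exists_interfaceNormSq_meanFlux_le d k hd1 hσ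
  refine ⟨2 * C + 1, by positivity, fun γ hγ Ω₁ Ω₂ hΩ => ?_⟩
  -- In `3 + γ`, each bulk energy counts once in `a` and twice in `s`, each flux norm once, and each
  -- jump norm `1 + γ` times.
  refine ⟨(6 + 2 * C)⁻¹, 3 + γ, by positivity, by linarith, fun M _ hM₂ => ⟨?_, ?_⟩⟩
  · exact fun u hu v hv => M.a_add_s_le hd1 hΩ (by linarith) hu hv
  · intro v hv
    refine M.le_a_add_s hd1 hΩ hC hγ hv ?_
    rw [← OverlapNitsche.OverlappingMeshes.sum_dirichletForm_snd hΩ hv]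
    exact htrace Ω₁ Ω₂ M hM₂ v hv
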